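/- Let $n\ge 1$, let $\mathfrak S_n$ be the set of permutations of $[n]=\{1,\dots,n\}$, and let $\mathfrak D_n\subseteq\mathfrak S_n$ be the set of derangements (permutations without fixed points). For $\sigma\in\mathfrak S_n$ let $\operatorname{wex}\sigma=\#\{i:\ i\le\sigma(i)\}$, $\operatorname{exc}\sigma=\#\{i:\ i<\sigma(i)\}$, $$\operatorname{cros}\sigma=\#\{(i,j)\in[n]\times[n]:\ i<j\le\sigma(i)<\sigma(j)\ \text{ or }\ i>j>\sigma(i)>\sigma(j)\},$$ $$\operatorname{nest}\sigma=\#\{(i,j)\in[n]\times[n]:\ i<j\le\sigma(j)<\sigma(i)\ \text{ or }\ i>j>\sigma(j)>\sigma(i)\}.$$ Let $(31\text{-}2)\sigma$ be the number of pairs $(i,j)$ with $2\le i<j\le n$ and $\sigma(i-1)>\sigma(j)>\sigma(i)$; let $(2\text{-}13)\sigma$ (respectively $(2\text{-}31)\sigma$) be the number of pairs $(i,j)$ with $1\le i<j\le n-1$ and $\sigma(j+1)>\sigma(i)>\sigma(j)$ (respectively $\sigma(j+1)<\sigma(i)<\sigma(j)$). Let $\mathfrak A_n$ be the set of falling alternating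 permutations $\sigma\in\mathfrak S_n$, i.e. those with $\sigma(1)>\sigma(2)<\sigma(3)>\sigma(4)<\cdots$. Then, for all elements $p,q$ of a commutative ring (in particular for indeterminates $p,q$), $$\sum_{\sigma\in\mathfrak S_n}(-1)^{\operatorname{wex}\sigma}p^{\operatorname{nest}\sigma}q^{\operatorname{cros}\sigma}=\begin{cases}0&\text{if $n$ is even},\\ (-1)^{\frac{n+1}{2}}\displaystyle\sum_{\sigma\in\mathfrak A_n}p^{(2\text{-}13)\sigma}q^{(31\text{-}2)\sigma}&\text{if $n$ is odd},\end{cases}$$ and, whenever $q$ is invertible, $$\sum_{\sigma\in\mathfrak D_n}\left(-\tfrac1q\right)^{\operatorname{exc}\sigma}p^{\operatorname{nest}\sigma}q^{\operatorname{cros}\sigma}=\begin{cases}\left(-\tfrac1q\right)^{\frac n2}\displaystyle\sum_{\sigma\in\mathfrak A_n}p^{(2\text{-}31)\sigma}q^{(31\text{-}2)\sigma}&\text{if $n$ is even},\\ 0&\text{if $n$ is odd}.\end{cases}$$ -/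

import Mathlib

namespace PermStat

/-- Number of weak excedances: indices `i` with `i ≤ σ(i)`. -/
def wex {n : ℕ} (σ : Equiv.Perm (Fin n)) : ℕ :=
  (Finset.univ.filter fun i : Fin n => i ≤ σ i).card

/-- Number of excedances: indices `i` with `i < σ(i)`. -/
def exc {n : ℕ} (σ : Equiv.Perm (Fin n)) : ℕ :=
  (Finset.univ.filter fun i : Fin n => i < σ i).card

/-- Number of crossings. -/
def cros {n : ℕ} (σ : Equiv.Perm (Fin n)) : ℕ :=
  (Finset.univ.filter fun x : Fin n × Fin n =>
    (x.1 < x.2 ∧ x.2 ≤ σ x.1 ∧ σ x.1 < σ x.2) ∨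
    (x.2 < x.1 ∧ σ x.1 < x.2 ∧ σ x.2 < σ x.1)).card

/-- Number of nestings. -/
def nest {n : ℕ} (σ : Equiv.Perm (Fin n)) : ℕ :=
  (Finset.univ.filter fun x : Fin n × Fin n =>
    (x.1 < x.2 ∧ x.2 ≤ σ x.2 ∧ σ x.2 < σ x.1) ∨
    (x.2 < x.1 ∧ σ x.2 < x.2 ∧ σ x.1 < σ x.2)).card

/-- Number of occurrences of the pattern 31-2: positions `a, b, c` with `b = a + 1`, `b < c`
and `σ(b) < σ(c) < σ(a)`. -/
def pat31_2 {n : ℕ} (σ : Equiv.Perm (Fin n)) : ℕ :=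
  (Finset.univ.filter fun x : Fin n × Fin n × Fin n =>
    x.1.val + 1 = x.2.1.val ∧ x.2.1 < x.2.2 ∧
      σ x.2.1 < σ x.2.2 ∧ σ x.2.2 < σ x.1).card

/-- Number of occurrences of the pattern 2-13: positions `a, b, c` with `a < b`, `c = b + 1`
and `σ(b) < σ(a) < σ(c)`. -/
def pat2_13 {n : ℕ} (σ : Equiv.Perm (Fin n)) : ℕ :=
  (Finset.univ.filter fun x : Fin n × Fin n × Fin n =>
    x.1 < x.2.1 ∧ x.2.1.val + 1 = x.2.2.val ∧
      σ x.2.1 < σ x.1 ∧ σ x.1 < σ x.2.2).card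

/-- Number of occurrences of the pattern 2-31: positions `a, b, c` with `a < b`, `c = b + 1`
and `σ(c) < σ(a) < σ(b)`. -/
def pat2_31 {n : ℕ} (σ : Equiv.Perm (Fin n)) : ℕ :=
  (Finset.univ.filter fun x : Fin n × Fin n × Fin n =>
    x.1 < x.2.1 ∧ x.2.1.val + 1 = x.2.2.val ∧
      σ x.2.2 < σ x.1 ∧ σ x.1 < σ x.2.1).card

/-- Falling alternating permutations, `σ(1) > σ(2) < σ(3) > ⋯`. Positions in `Fin n` start
at `0`, so the descents are exactly at the even positions. -/
def alternating (n : ℕ) : Finset (Equiv.Perm (Fin n)) :=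
  Finset.univ.filter fun σ => ∀ i j : Fin n, i.val + 1 = j.val →
    (i.val % 2 = 0 → σ j < σ i) ∧ (i.val % 2 = 1 → σ i < σ j)

end PermStat

namespace PermStat

/-! Both sides are reduced to one three-term recurrence, that of weighted Dyck paths whose steps at
height `h` carry the (p,q)-integers `br p q h`.

Permutations: read the arc diagram from left to right. With `h` arcs open on each side, the state is
a permutation whose positions below `h` have values at least `h`. Position `h` either stays open or
takes an open value `v < h`, creating `v` nestings and `h - 1 - v` crossings. Value `h` either stays
open or is taken by an open position `i ≤ h`, creating one weak excedance, `i` nestings and `h - i`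
crossings. Summing over `v` and `i` produces (p,q)-integers (`permSum_diag`, `permSum_new`,
`permSum_old`), hence a Motzkin-type recurrence with `y` marking weak excedances and `z` fixed
points. In both specializations the level steps cancel: for `y = -1`, `z = 1` after passing to the
half-step sums (`oldSum_neg_one_succ`), and for `z = 0`, `y * q = -1` directly. What is left are
Dyck paths, which explains the vanishing for one parity and the power in front for the other.
Rescaling by the (p,q)-factorial gives `zigSum` (`eq_zigSum_zero`, `eq_zigSum_one`).

Alternating permutations: cut the word into pairs (peak, valley), with a final valley `0` if `n` is
odd (`d = 1`). Erase the values in increasing order: a valley becomes `0`, and a peak, whose valley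
is already `0`, disappears with its pair. Conversely a value fills a zero valley or enters as a new
pair, at the front or just behind a zero valley. Ranking these choices again gives (p,q)-integers,
so the sum satisfies the recurrence of `zigSum` (`wordSum_eq_zigSum`).

The weights match because the pairs straddling a value at the moment of its erasure are exactly
those with zero valley. Those on the left count 31-2 and those on the right count 2-31. For odd `n`
the pattern 2-13 counts straddling ascents instead, which `straddle_telescope` compares with
straddling descents. -/

open Finset

/-! ### Inserting a position and its value into a permutation. -/

/-- The permutation of `Fin (N + 1)` obtained from `τ` by inserting the position `i`
with image `v`. -/
def ins {N : ℕ} (i v : Fin (N + 1)) (τ : Equiv.Perm (Fin N)) : Equiv.Perm (Fin (N + 1)) :=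
  (finSuccEquiv' i).trans ((Equiv.optionCongr τ).trans (finSuccEquiv' v).symm)

@[simp] lemma ins_self {N : ℕ} (i v : Fin (N + 1)) (τ : Equiv.Perm (Fin N)) :
    ins i v τ i = v := by
  simp [ins]

@[simp] lemma ins_succAbove {N : ℕ} (i v : Fin (N + 1)) (τ : Equiv.Perm (Fin N)) (k : Fin N) :
    ins i v τ (i.succAbove k) = v.succAbove (τ k) := by
  simp [ins]

lemma ins_injective {N : ℕ} (i v : Fin (N + 1)) : Function.Injective (ins i v) := by
  intro τ τ' h
  ext k
  have := congrArg (fun σ => σ (i.succAbove k)) h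
  simp only [ins_succAbove, Fin.succAbove_right_inj] at this
  rw [this]

lemma ins_bijective_value {N : ℕ} (i : Fin (N + 1)) :
    Function.Bijective fun x : Fin (N + 1) × Equiv.Perm (Fin N) => ins i x.1 x.2 := by
  rw [Fintype.bijective_iff_injective_and_card]
  constructor
  · rintro ⟨v, τ⟩ ⟨v', τ'⟩ h
    have hv : v = v' := by simpa using congrArg (fun σ => σ i) h
    subst hv
    simp only [Prod.mk.injEq, true_and]
    exact ins_injective i v h
  · simp [Fintype.card_perm, Nat.factorial_succ]

lemma ins_bijective_position {N : ℕ} (v : Fin (N + 1)) :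
    Function.Bijective fun x : Fin (N + 1) × Equiv.Perm (Fin N) => ins x.1 v x.2 := by
  rw [Fintype.bijective_iff_injective_and_card]
  constructor
  · rintro ⟨i, τ⟩ ⟨i', τ'⟩ h
    have hv : i = i' := by
      have h1 : ins i v τ i = ins i' v τ' i' := by simp
      rw [show ins i' v τ' = ins i v τ from h.symm] at h1
      exact (ins i v τ).injective h1
    subst hv
    simp only [Prod.mk.injEq, true_and]
    exact ins_injective i v h
  · simp [Fintype.card_perm, Nat.factorial_succ]

lemma sum_perm_value {A : Type*} [AddCommMonoid A] {N : ℕ} (i : Fin (N + 1))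
    (f : Equiv.Perm (Fin (N + 1)) → A) :
    ∑ σ, f σ = ∑ v, ∑ τ, f (ins i v τ) := by
  rw [← Fintype.sum_prod_type' (fun v τ => f (ins i v τ))]
  exact ((ins_bijective_value i).sum_comp f).symm

lemma sum_perm_position {A : Type*} [AddCommMonoid A] {N : ℕ} (v : Fin (N + 1))
    (f : Equiv.Perm (Fin (N + 1)) → A) :
    ∑ σ, f σ = ∑ i, ∑ τ, f (ins i v τ) := by
  rw [← Fintype.sum_prod_type' (fun i τ => f (ins i v τ))]
  exact ((ins_bijective_position v).sum_comp f).symm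

lemma succAbove_val_cases {N : ℕ} (i : Fin (N + 1)) (k : Fin N) :
    (k.val < i.val ∧ (i.succAbove k).val = k.val) ∨
      (i.val ≤ k.val ∧ (i.succAbove k).val = k.val + 1) := by
  rcases lt_or_ge k.val i.val with h | h
  · exact Or.inl ⟨h, by rw [Fin.succAbove_of_castSucc_lt _ _ (by simpa [Fin.lt_def] using h)]; rfl⟩
  · exact Or.inr ⟨h, by rw [Fin.succAbove_of_le_castSucc _ _ (by simpa [Fin.le_def] using h)]; rfl⟩

/-- Separates the pairs that avoid the inserted position from those that involve it, so that a pair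
statistic is the old statistic plus a correction. -/
lemma sum_sum_succAbove {N : ℕ} (i : Fin (N + 1)) (g : Fin (N + 1) → Fin (N + 1) → ℕ) :
    ∑ x, ∑ y, g x y = ∑ k, ∑ l, g (i.succAbove k) (i.succAbove l) +
      (g i i + ∑ k, (g i (i.succAbove k) + g (i.succAbove k) i)) := by
  rw [Fin.sum_univ_succAbove _ i, Fin.sum_univ_succAbove _ i]
  simp_rw [Fin.sum_univ_succAbove (g (i.succAbove _)) i, Finset.sum_add_distrib]
  ring

lemma sum_interval_indicator {N : ℕ} (a b : ℕ) (hb : b ≤ N) :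
    ∑ k : Fin N, (if a ≤ k.val ∧ k.val < b then 1 else 0) = b - a := by
  rw [Fin.sum_univ_eq_sum_range (fun k => if a ≤ k ∧ k < b then 1 else 0), ← Finset.card_filter,
    show (Finset.range N).filter (fun k => a ≤ k ∧ k < b) = Finset.Ico a b by ext; simp; omega]
  simp

/-- The number of fixed points `i` with `f ≤ i`. -/
def fixFrom {n : ℕ} (f : ℕ) (σ : Equiv.Perm (Fin n)) : ℕ :=
  (Finset.univ.filter fun i : Fin n => f ≤ i.val ∧ σ i = i).card

/-- The positions below `a` are mapped to values at least `b`. -/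
def Adm {n : ℕ} (a b : ℕ) (σ : Equiv.Perm (Fin n)) : Prop :=
  ∀ i : Fin n, i.val < a → b ≤ (σ i).val

instance {n : ℕ} (a b : ℕ) : DecidablePred (Adm (n := n) a b) :=
  fun _ => inferInstanceAs (Decidable (∀ _, _))

lemma cros_eq_sum {n : ℕ} (σ : Equiv.Perm (Fin n)) :
    cros σ = ∑ x, ∑ y, if (x < y ∧ y ≤ σ x ∧ σ x < σ y) ∨ (y < x ∧ σ x < y ∧ σ y < σ x)
      then 1 else 0 := by
  rw [cros, Finset.card_filter, Fintype.sum_prod_type]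

lemma nest_eq_sum {n : ℕ} (σ : Equiv.Perm (Fin n)) :
    nest σ = ∑ x, ∑ y, if (x < y ∧ y ≤ σ y ∧ σ y < σ x) ∨ (y < x ∧ σ y < y ∧ σ x < σ y)
      then 1 else 0 := by
  rw [nest, Finset.card_filter, Fintype.sum_prod_type]

/-! ### Closing a lower arc: position `h` receives an open value `v < h`. -/

section Lower

variable {N : ℕ} {h v : Fin (N + 1)} {τ : Equiv.Perm (Fin N)}

lemma adm_ins_lower (hv : v < h) :
    Adm h.val h.val (ins h v τ) ↔ Adm h.val (h.val - 1) τ := by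
  constructor
  · intro H k hk
    have h1 := H (h.succAbove k)
    rw [ins_succAbove] at h1
    have := succAbove_val_cases h k
    have := succAbove_val_cases v (τ k)
    rw [Fin.lt_def] at hv
    omega
  · intro H j hj
    obtain rfl | ⟨k, rfl⟩ := Fin.eq_self_or_eq_succAbove h j
    · omega
    · have h1 := H k
      rw [ins_succAbove]
      have := succAbove_val_cases h k
      have := succAbove_val_cases v (τ k)
      rw [Fin.lt_def] at hv
      omega

lemma wex_ins_lower (hv : v < h) (H : Adm h.val (h.val - 1) τ) : wex (ins h v τ) = wex τ := by
  rw [wex, wex, Finset.card_filter, Finset.card_filter, Fin.sum_univ_succAbove _ h, ins_self,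
    if_neg (not_le.mpr hv), zero_add]
  refine Finset.sum_congr rfl fun k _ => if_congr ?_ rfl rfl
  rw [ins_succAbove]
  have := succAbove_val_cases h k
  have := succAbove_val_cases v (τ k)
  have := H k
  rw [Fin.lt_def] at hv
  rw [Fin.le_def, Fin.le_def]
  omega

lemma fixFrom_ins_lower (hv : v < h) :
    fixFrom h.val (ins h v τ) = fixFrom h.val τ := by
  rw [fixFrom, fixFrom, Finset.card_filter, Finset.card_filter, Fin.sum_univ_succAbove _ h,
    ins_self, if_neg (fun x => hv.ne x.2), zero_add]
  refine Finset.sum_congr rfl fun k _ => if_congr ?_ rfl rfl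
  rw [ins_succAbove]
  have := succAbove_val_cases h k
  have := succAbove_val_cases v (τ k)
  rw [Fin.lt_def] at hv
  rw [Fin.ext_iff, Fin.ext_iff]
  omega

/-- By admissibility every value of `τ` below `h - 1` sits at a position at least `h`, hence to the
right of the new arc once inserted. Those from `v` on cross the new arc, those below `v` are nested
with it. The count runs over values, whence the reindexing along `τ`. -/
lemma cros_ins_lower (hv : v < h) (H : Adm h.val (h.val - 1) τ) :
    cros (ins h v τ) = cros τ + (h.val - 1 - v.val) := by
  rw [cros_eq_sum, cros_eq_sum, sum_sum_succAbove h]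
  rw [Fin.lt_def] at hv
  congr 1
  · refine Finset.sum_congr rfl fun k _ => Finset.sum_congr rfl fun l _ => if_congr ?_ rfl rfl
    simp only [ins_succAbove, Fin.lt_def, Fin.le_def]
    have := succAbove_val_cases h k
    have := succAbove_val_cases v (τ k)
    have := succAbove_val_cases h l
    have := succAbove_val_cases v (τ l)
    have := H k
    have := H l
    omega
  · rw [if_neg (by simp), zero_add,
      ← sum_interval_indicator (N := N) v.val (h.val - 1) (by omega),
      ← Equiv.sum_comp τ (fun w => if v.val ≤ w.val ∧ w.val < h.val - 1 then 1 else 0)]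
    refine Finset.sum_congr rfl fun k _ => ?_
    simp only [ins_succAbove, ins_self, Fin.lt_def, Fin.le_def]
    have := succAbove_val_cases h k
    have := succAbove_val_cases v (τ k)
    have := H k
    rw [if_neg (by omega), zero_add]
    exact if_congr (by omega) rfl rfl

lemma nest_ins_lower (hv : v < h) (H : Adm h.val (h.val - 1) τ) :
    nest (ins h v τ) = nest τ + v.val := by
  rw [nest_eq_sum, nest_eq_sum, sum_sum_succAbove h]
  rw [Fin.lt_def] at hv
  congr 1
  · refine Finset.sum_congr rfl fun k _ => Finset.sum_congr rfl fun l _ => if_congr ?_ rfl rfl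
    simp only [ins_succAbove, Fin.lt_def, Fin.le_def]
    have := succAbove_val_cases h k
    have := succAbove_val_cases v (τ k)
    have := succAbove_val_cases h l
    have := succAbove_val_cases v (τ l)
    have := H k
    have := H l
    omega
  · rw [if_neg (by simp), zero_add, ← Nat.sub_zero v.val,
      ← sum_interval_indicator (N := N) 0 v.val (by omega),
      ← Equiv.sum_comp τ (fun w => if 0 ≤ w.val ∧ w.val < v.val then 1 else 0)]
    refine Finset.sum_congr rfl fun k _ => ?_
    simp only [ins_succAbove, ins_self, Fin.lt_def, Fin.le_def]
    have := succAbove_val_cases h k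
    have := succAbove_val_cases v (τ k)
    have := H k
    rw [if_neg (by omega), zero_add]
    exact if_congr (by omega) rfl rfl

end Lower

/-! ### Closing an upper arc: value `h` is taken by an open position `i ≤ h`. -/

section Upper

variable {N : ℕ} {h i : Fin (N + 1)} {τ : Equiv.Perm (Fin N)}

lemma adm_ins_upper (hi : i ≤ h) :
    Adm (h.val + 1) h.val (ins i h τ) ↔ Adm h.val h.val τ := by
  constructor
  · intro H k hk
    have h1 := H (i.succAbove k)
    rw [ins_succAbove] at h1
    have := succAbove_val_cases i k
    have := succAbove_val_cases h (τ k)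
    rw [Fin.le_def] at hi
    omega
  · intro H j hj
    obtain rfl | ⟨k, rfl⟩ := Fin.eq_self_or_eq_succAbove i j
    · simp
    · have h1 := H k
      rw [ins_succAbove]
      have := succAbove_val_cases i k
      have := succAbove_val_cases h (τ k)
      rw [Fin.le_def] at hi
      omega

lemma wex_ins_upper (hi : i ≤ h) (H : Adm h.val h.val τ) :
    wex (ins i h τ) = wex τ + 1 := by
  rw [wex, wex, Finset.card_filter, Finset.card_filter, Fin.sum_univ_succAbove _ i, ins_self,
    if_pos hi, add_comm]
  congr 1
  refine Finset.sum_congr rfl fun k _ => if_congr ?_ rfl rfl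
  rw [ins_succAbove]
  have := succAbove_val_cases i k
  have := succAbove_val_cases h (τ k)
  have := H k
  rw [Fin.le_def] at hi
  rw [Fin.le_def, Fin.le_def]
  omega

lemma fixFrom_ins_upper (hi : i ≤ h) (H : Adm h.val h.val τ) :
    fixFrom h.val (ins i h τ) = fixFrom h.val τ + if i = h then 1 else 0 := by
  rw [fixFrom, fixFrom, Finset.card_filter, Finset.card_filter, Fin.sum_univ_succAbove _ i,
    ins_self, add_comm]
  congr 1
  · refine Finset.sum_congr rfl fun k _ => if_congr ?_ rfl rfl
    rw [ins_succAbove]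
    have := succAbove_val_cases i k
    have := succAbove_val_cases h (τ k)
    have := H k
    rw [Fin.le_def] at hi
    rw [Fin.ext_iff, Fin.ext_iff]
    omega
  · refine if_congr ?_ rfl rfl
    rw [Fin.ext_iff, Fin.ext_iff]
    omega

/-- The threshold `h + 1` serves the case where position `h` is an old open position: then even `i =
h` is only a coincidence of relabelled indices and must not count as a fixed point. -/
lemma fixFrom_succ_ins_upper (hi : i ≤ h) (H : Adm h.val h.val τ) :
    fixFrom (h.val + 1) (ins i h τ) = fixFrom h.val τ := by
  rw [fixFrom, fixFrom, Finset.card_filter, Finset.card_filter, Fin.sum_univ_succAbove _ i,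
    ins_self]
  rw [Fin.le_def] at hi
  rw [if_neg (by omega), zero_add]
  refine Finset.sum_congr rfl fun k _ => if_congr ?_ rfl rfl
  rw [ins_succAbove]
  have := succAbove_val_cases i k
  have := succAbove_val_cases h (τ k)
  have := H k
  rw [Fin.ext_iff, Fin.ext_iff]
  omega

/-- Open positions of `τ` have values at least `h`, which end up above the inserted value. Those at
or after `i` give crossings, those before `i` give nestings. -/
lemma cros_ins_upper (hi : i ≤ h) (H : Adm h.val h.val τ) :
    cros (ins i h τ) = cros τ + (h.val - i.val) := by
  rw [cros_eq_sum, cros_eq_sum, sum_sum_succAbove i]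
  rw [Fin.le_def] at hi
  congr 1
  · refine Finset.sum_congr rfl fun k _ => Finset.sum_congr rfl fun l _ => if_congr ?_ rfl rfl
    simp only [ins_succAbove, Fin.lt_def, Fin.le_def]
    have := succAbove_val_cases i k
    have := succAbove_val_cases h (τ k)
    have := succAbove_val_cases i l
    have := succAbove_val_cases h (τ l)
    have := H k
    have := H l
    omega
  · rw [if_neg (by simp), zero_add,
      ← sum_interval_indicator (N := N) i.val h.val (by omega)]
    refine Finset.sum_congr rfl fun k _ => ?_
    simp only [ins_succAbove, ins_self, Fin.lt_def, Fin.le_def]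
    have := succAbove_val_cases i k
    have := succAbove_val_cases h (τ k)
    have := H k
    rw [add_comm, if_neg (by omega), zero_add]
    exact if_congr (by omega) rfl rfl

lemma nest_ins_upper (hi : i ≤ h) (H : Adm h.val h.val τ) :
    nest (ins i h τ) = nest τ + i.val := by
  rw [nest_eq_sum, nest_eq_sum, sum_sum_succAbove i]
  rw [Fin.le_def] at hi
  congr 1
  · refine Finset.sum_congr rfl fun k _ => Finset.sum_congr rfl fun l _ => if_congr ?_ rfl rfl
    simp only [ins_succAbove, Fin.lt_def, Fin.le_def]
    have := succAbove_val_cases i k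
    have := succAbove_val_cases h (τ k)
    have := succAbove_val_cases i l
    have := succAbove_val_cases h (τ l)
    have := H k
    have := H l
    omega
  · rw [if_neg (by simp), zero_add, ← Nat.sub_zero i.val,
      ← sum_interval_indicator (N := N) 0 i.val (by omega)]
    refine Finset.sum_congr rfl fun k _ => ?_
    simp only [ins_succAbove, ins_self, Fin.lt_def, Fin.le_def]
    have := succAbove_val_cases i k
    have := succAbove_val_cases h (τ k)
    have := H k
    rw [if_neg (by omega), zero_add]
    exact if_congr (by omega) rfl rfl

end Upper

end PermStat

namespace PermStat

open Finset

/-! ### Recurrences for the sums over admissible permutations. -/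

section Recurrences

variable {R : Type*} [CommRing R] (p q y z : R)

/-- The `(p, q)`-analogue of the natural number `h`. -/
def br (h : ℕ) : R := ∑ k ∈ range h, p ^ k * q ^ (h - 1 - k)

@[simp] lemma br_zero : br p q 0 = 0 := by simp [br]

@[simp] lemma br_one : br p q 1 = 1 := by simp [br]

lemma br_succ (h : ℕ) : br p q (h + 1) = q * br p q h + p ^ h := by
  rw [br, br, Finset.sum_range_succ, Finset.mul_sum]
  congr 1
  · refine Finset.sum_congr rfl fun k hk => ?_
    rw [Finset.mem_range] at hk
    rw [show h + 1 - 1 - k = h - 1 - k + 1 by omega, pow_succ]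
    ring
  · simp

/-- The weight of a permutation. -/
def permWeight (f : ℕ) {N : ℕ} (σ : Equiv.Perm (Fin N)) : R :=
  y ^ wex σ * z ^ fixFrom f σ * p ^ nest σ * q ^ cros σ

/-- The weighted sum over the permutations which map positions below `a` to values at
least `b`. -/
def permSum (N a b f : ℕ) : R :=
  ∑ σ : Equiv.Perm (Fin N), if Adm a b σ then permWeight p q y z f σ else 0

lemma sum_fin_lt {N : ℕ} (h : ℕ) (hN : h ≤ N) (F : ℕ → R) :
    ∑ v : Fin N, (if v.val < h then F v.val else 0) = ∑ k ∈ range h, F k := by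
  rw [Fin.sum_univ_eq_sum_range (fun k => if k < h then F k else 0), ← Finset.sum_filter]
  congr 1
  ext
  simp
  omega

lemma adm_succ_left_iff {N : ℕ} (h : Fin N) (b : ℕ) (σ : Equiv.Perm (Fin N)) :
    Adm (h.val + 1) b σ ↔ Adm h.val b σ ∧ b ≤ (σ h).val := by
  refine ⟨fun H => ⟨fun i hi => H i (by omega), H h (by omega)⟩, fun H i hi => ?_⟩
  rcases Nat.lt_succ_iff_lt_or_eq.mp hi with hi | hi
  · exact H.1 i hi
  · rw [Fin.ext hi]
    exact H.2

/-- Splits according to whether position `h` stays open or takes one of the `h` open values; in the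
second case that position is removed. -/
lemma permSum_diag (N : ℕ) (h : Fin (N + 1)) :
    permSum p q y z (N + 1) h h h = permSum p q y z (N + 1) (h + 1) h h +
      br p q h * permSum p q y z N h (h - 1) h := by
  have split : permSum p q y z (N + 1) h h h = permSum p q y z (N + 1) (h + 1) h h +
      ∑ σ : Equiv.Perm (Fin (N + 1)),
        if σ h < h then (if Adm h.val h.val σ then permWeight p q y z h σ else 0) else 0 := by
    rw [permSum, permSum, ← Finset.sum_add_distrib]
    refine Finset.sum_congr rfl fun σ _ => ?_
    simp only [adm_succ_left_iff h h.val σ, Fin.lt_def]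
    by_cases h1 : Adm h.val h.val σ <;> by_cases h2 : (σ h).val < h.val <;>
      simp [h1, h2]
    · omega
    · intro h3
      omega
  rw [split, sum_perm_value h]
  congr 1
  have key : ∀ v : Fin (N + 1), (∑ τ : Equiv.Perm (Fin N), if ins h v τ h < h then
      (if Adm h.val h.val (ins h v τ) then permWeight p q y z h (ins h v τ) else 0) else 0) =
      if v.val < h.val then p ^ v.val * q ^ (h.val - 1 - v.val) *
        permSum p q y z N h (h - 1) h else 0 := by
    intro v
    simp only [ins_self]
    by_cases hv : v < h
    · rw [if_pos (Fin.lt_def.mp hv), permSum, Finset.mul_sum]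
      refine Finset.sum_congr rfl fun τ _ => ?_
      rw [if_pos hv, mul_ite, mul_zero]
      refine if_ctx_congr (adm_ins_lower hv) (fun H => ?_) (fun _ => rfl)
      rw [permWeight, permWeight, wex_ins_lower hv H, fixFrom_ins_lower hv,
        cros_ins_lower hv H, nest_ins_lower hv H]
      ring
    · simp [hv]
  rw [Finset.sum_congr rfl fun v _ => key v,
    sum_fin_lt h.val (by omega) (fun k => p ^ k * q ^ (h.val - 1 - k) *
        permSum p q y z N h (h - 1) h), ← Finset.sum_mul, br]

lemma adm_succ_right_iff {N : ℕ} (h : Fin N) (σ : Equiv.Perm (Fin N)) :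
    Adm (h.val + 1) (h.val + 1) σ ↔ Adm (h.val + 1) h.val σ ∧ h < σ.symm h := by
  rw [Fin.lt_def]
  constructor
  · refine fun H => ⟨fun i hi => (Nat.le_succ _).trans (H i hi), ?_⟩
    by_contra h1
    have := H (σ.symm h) (by omega)
    simp at this
  · intro H i hi
    have h1 := H.1 i hi
    have h2 : σ i ≠ h := by
      rintro rfl
      simp at H
      omega
    rw [Ne, Fin.ext_iff] at h2
    omega

/-- Splits according to whether value `h` stays open or is taken by a position `i ≤ h`. The factor
`c` and the threshold `f` are left free because a fresh position `h` can create a fixed point and an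
old one cannot. -/
lemma permSum_step_aux (N : ℕ) (h : Fin (N + 1)) (f : ℕ) (c : ℕ → R)
    (hw : ∀ i : Fin (N + 1), i ≤ h → ∀ τ : Equiv.Perm (Fin N), Adm h.val h.val τ →
      permWeight p q y z f (ins i h τ) = c i * permWeight p q y z h τ)
    (hf : ∀ σ : Equiv.Perm (Fin (N + 1)), h < σ.symm h →
      permWeight p q y z f σ = permWeight p q y z (h + 1) σ) :
    permSum p q y z (N + 1) (h + 1) h f = permSum p q y z (N + 1) (h + 1) (h + 1) (h + 1) +
      (∑ i ∈ range (h + 1), c i) * permSum p q y z N h h h := by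
  have split : permSum p q y z (N + 1) (h + 1) h f =
      permSum p q y z (N + 1) (h + 1) (h + 1) (h + 1) +
      ∑ σ : Equiv.Perm (Fin (N + 1)), if σ.symm h ≤ h then
        (if Adm (h.val + 1) h.val σ then permWeight p q y z f σ else 0) else 0 := by
    rw [permSum, permSum, ← Finset.sum_add_distrib]
    refine Finset.sum_congr rfl fun σ _ => ?_
    simp only [adm_succ_right_iff h σ]
    by_cases h1 : Adm (h.val + 1) h.val σ <;> by_cases h2 : σ.symm h ≤ h
    · simp [h1, h2, not_lt.mpr h2]
    · simp [h1, h2, not_le.mp h2, hf σ (not_le.mp h2)]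
    · simp [h1]
    · simp [h1]
  rw [split, sum_perm_position h]
  congr 1
  have key : ∀ i : Fin (N + 1), (∑ τ : Equiv.Perm (Fin N), if (ins i h τ).symm h ≤ h then
      (if Adm (h.val + 1) h.val (ins i h τ) then permWeight p q y z f (ins i h τ) else 0)
        else 0) =
      if i.val < h.val + 1 then c i * permSum p q y z N h h h else 0 := by
    intro i
    have hs : ∀ τ : Equiv.Perm (Fin N), (ins i h τ).symm h = i := fun τ => by
      rw [Equiv.symm_apply_eq, ins_self]
    simp only [hs]
    by_cases hi : i ≤ h
    · rw [if_pos (Nat.lt_succ_of_le (Fin.le_def.mp hi)), permSum, Finset.mul_sum]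
      refine Finset.sum_congr rfl fun τ _ => ?_
      rw [if_pos hi, mul_ite, mul_zero]
      exact if_ctx_congr (adm_ins_upper hi) (fun H => hw i hi τ H) (fun _ => rfl)
    · rw [if_neg (by rw [Fin.le_def] at hi; omega)]
      simp [hi]
  rw [Finset.sum_congr rfl fun i _ => key i,
    sum_fin_lt (h.val + 1) (by omega) (fun k => c k * permSum p q y z N h h h),
    ← Finset.sum_mul]

lemma sum_upper_weight (h : ℕ) :
    ∑ i ∈ range (h + 1), y * p ^ i * q ^ (h - i) = y * br p q (h + 1) := by
  rw [br, Finset.mul_sum]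
  refine Finset.sum_congr rfl fun k _ => ?_
  rw [Nat.add_sub_cancel]
  ring

lemma permSum_old (N : ℕ) (h : Fin (N + 1)) :
    permSum p q y z (N + 1) (h + 1) h (h + 1) =
      permSum p q y z (N + 1) (h + 1) (h + 1) (h + 1) +
      y * br p q (h + 1) * permSum p q y z N h h h := by
  rw [permSum_step_aux p q y z N h (h + 1) (fun i => y * p ^ i * q ^ (h.val - i)),
    sum_upper_weight]
  · intro i hi τ H
    rw [permWeight, permWeight, wex_ins_upper hi H, fixFrom_succ_ins_upper hi H,
      cros_ins_upper hi H, nest_ins_upper hi H]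
    ring
  · exact fun _ _ => rfl

lemma permSum_new (N : ℕ) (h : Fin (N + 1)) :
    permSum p q y z (N + 1) (h + 1) h h =
      permSum p q y z (N + 1) (h + 1) (h + 1) (h + 1) +
      y * (q * br p q h + z * p ^ h.val) * permSum p q y z N h h h := by
  rw [permSum_step_aux p q y z N h h
    (fun i => y * p ^ i * q ^ (h.val - i) * z ^ (if i = h.val then 1 else 0))]
  · rw [Finset.sum_range_succ]
    congr 2
    rw [br, mul_add, Finset.mul_sum, Finset.mul_sum]
    congr 1
    · refine Finset.sum_congr rfl fun k hk => ?_
      rw [Finset.mem_range] at hk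
      rw [if_neg hk.ne, show h.val - k = h.val - 1 - k + 1 by omega]
      ring
    · simp
      ring
  · intro i hi τ H
    rw [permWeight, permWeight, wex_ins_upper hi H, fixFrom_ins_upper hi H,
      cros_ins_upper hi H, nest_ins_upper hi H]
    simp only [Fin.ext_iff]
    ring
  · intro σ hσ
    have : fixFrom h.val σ = fixFrom (h.val + 1) σ := by
      rw [fixFrom, fixFrom]
      congr 1
      refine Finset.filter_congr fun i _ => ?_
      refine ⟨fun H => ⟨?_, H.2⟩, fun H => ⟨by omega, H.2⟩⟩
      -- Raising the threshold past `h` loses nothing: value `h` is still open, so `h` is not fixed.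
      refine lt_of_le_of_ne H.1 fun h1 => ?_
      have h2 : h = i := Fin.ext h1
      rw [h2, (Equiv.symm_apply_eq σ).mpr H.2.symm] at hσ
      exact lt_irrefl _ hσ
    rw [permWeight, permWeight, this]

lemma permSum_terminal (h f : ℕ) :
    permSum p q y z h h h f = if h = 0 then 1 else 0 := by
  rcases Nat.eq_zero_or_pos h with rfl | hh
  · simp [permSum, permWeight, Adm, wex, fixFrom, nest, cros]
  · rw [if_neg hh.ne', permSum]
    refine Finset.sum_eq_zero fun σ _ => if_neg fun H => ?_
    have := H ⟨0, hh⟩ hh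
    have := (σ ⟨0, hh⟩).isLt
    omega

end Recurrences

end PermStat

namespace PermStat

open Finset

/-! ### Specializations without level steps, and their solution by `zigSum`. -/

section Recurrences

variable {R : Type*} [CommRing R] (p q y z : R)

/-- The weighted sum over the configurations with `h` open arcs on each side and `r` remaining
steps. -/
def diagSum (r h : ℕ) : R := permSum p q y z (r + h) h h h

/-- The weighted sum over the configurations with `h + 1` open positions, `h` open values and
`r` remaining full steps. -/
def oldSum (r h : ℕ) : R := permSum p q y z (r + 1 + h) (h + 1) h (h + 1)

lemma diagSum_zero (h : ℕ) : diagSum p q y z 0 h = if h = 0 then 1 else 0 := by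
  rw [diagSum, Nat.zero_add, permSum_terminal]

/-- The factor `br p q 0 = 0` makes the truncated index `h - 1` harmless at `h = 0`. -/
lemma permSum_diag_oldSum (r h : ℕ) :
    br p q h * permSum p q y z (r + h) h (h - 1) h = br p q h * oldSum p q y z r (h - 1) := by
  rcases h with _ | h
  · simp
  · rw [oldSum, Nat.add_sub_cancel, show r + (h + 1) = r + 1 + h by ring]

lemma oldSum_eq (r h : ℕ) :
    oldSum p q y z r h = diagSum p q y z r (h + 1) + y * br p q (h + 1) * diagSum p q y z r h := by
  have := permSum_old p q y z (r + h) ⟨h, by omega⟩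
  simp only at this
  rw [oldSum, diagSum, diagSum, show r + 1 + h = r + h + 1 by ring, this]
  rfl

lemma diagSum_succ (r h : ℕ) :
    diagSum p q y z (r + 1) h = diagSum p q y z r (h + 1) +
      y * (q * br p q h + z * p ^ h) * diagSum p q y z r h + br p q h * oldSum p q y z r (h - 1) := by
  have h1 := permSum_diag p q y z (r + h) ⟨h, by omega⟩
  have h2 := permSum_new p q y z (r + h) ⟨h, by omega⟩
  simp only at h1 h2
  rw [permSum_diag_oldSum] at h1
  rw [diagSum, show r + 1 + h = r + h + 1 by ring, h1, h2]
  rfl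

lemma br_mul_diagSum_pred (r h : ℕ) :
    br p q h * oldSum p q y z r (h - 1) = br p q h * diagSum p q y z r h +
      y * br p q h ^ 2 * diagSum p q y z r (h - 1) := by
  rcases h with _ | h
  · simp
  · rw [oldSum_eq, Nat.add_sub_cancel]
    ring

/-- With `z = 1` the level coefficient becomes `y * br p q (h + 1)`, the same as in `oldSum_eq`, so
a full step factors into two half steps. -/
lemma diagSum_succ_eq_oldSum (r h : ℕ) :
    diagSum p q y 1 (r + 1) h = oldSum p q y 1 r h + br p q h * oldSum p q y 1 r (h - 1) := by
  rw [diagSum_succ, oldSum_eq p q y 1 r h, br_succ]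
  ring

lemma oldSum_neg_one_zero (h : ℕ) :
    oldSum p q (-1) 1 0 h = if h = 0 then -1 else 0 := by
  rw [oldSum_eq, diagSum_zero, diagSum_zero]
  split_ifs with h1 h2 <;> simp_all

/-- Composing the half steps in the other order, the two terms `br p q (h + 1) * oldSum r h` have
opposite signs and cancel. -/
lemma oldSum_neg_one_succ (r h : ℕ) :
    oldSum p q (-1) 1 (r + 1) h = oldSum p q (-1) 1 r (h + 1) -
      br p q h * br p q (h + 1) * oldSum p q (-1) 1 r (h - 1) := by
  rw [oldSum_eq, diagSum_succ_eq_oldSum, diagSum_succ_eq_oldSum, Nat.add_sub_cancel]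
  ring

/-- The recurrence for the weighted count of alternating words. -/
def zigSum (d : ℕ) : ℕ → ℕ → R
  | 0, h => if h = 0 then 1 else 0
  | r + 1, h => br p q (h + 1 - d) * zigSum d r (h + 1) + br p q h * zigSum d r (h - 1)

/-- The `(p, q)`-factorial. -/
def brFactorial (h : ℕ) : R := ∏ k ∈ range h, br p q (k + 1)

lemma brFactorial_succ (h : ℕ) :
    brFactorial p q (h + 1) = brFactorial p q h * br p q (h + 1) :=
  Finset.prod_range_succ _ _

lemma zigSum_one_succ_zero (r : ℕ) : zigSum p q 1 (r + 1) 0 = 0 := by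
  simp [zigSum]

/-- A three-term recurrence determines its solution in terms of `zigSum`, for `d = 0`. -/
lemma eq_zigSum_zero (u : R) (M : ℕ → ℕ → R) (h0 : ∀ h, M 0 h = if h = 0 then 1 else 0)
    (hs : ∀ r h, M (r + 1) h = M r (h + 1) + u * br p q h ^ 2 * M r (h - 1)) (r h : ℕ) :
    M r h = if Even (r + h) then u ^ ((r + h) / 2) * brFactorial p q h * zigSum p q 0 r h
      else 0 := by
  induction r generalizing h with
  | zero =>
    rw [h0, zigSum]
    rcases h with _ | h <;> simp [brFactorial]
  | succ r ih =>
    rw [hs, ih, ih, zigSum]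
    have e1 : r + (h + 1) = r + 1 + h := by ring
    rw [e1]
    rcases h with _ | h
    · split_ifs <;> simp [brFactorial]
    · have e2 : r + 1 + (h + 1) = r + h + 2 := by ring
      have e3 : Even (r + h + 2) ↔ Even (r + h) := by simp [parity_simps]
      rw [e2, Nat.add_sub_cancel, show (r + h + 2) / 2 = (r + h) / 2 + 1 by omega]
      simp only [e3]
      split_ifs
      -- The rescaling moves one factor `br` from the down step to the up step, leaving each step
      -- linear in `br`.
      · rw [brFactorial_succ, brFactorial_succ, Nat.sub_zero]
        ring
      · ring

/-- A three-term recurrence determines its solution in terms of `zigSum`, for `d = 1`. -/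
lemma eq_zigSum_one (M : ℕ → ℕ → R) (h0 : ∀ h, M 0 h = if h = 0 then -1 else 0)
    (hs : ∀ r h, M (r + 1) h = M r (h + 1) - br p q h * br p q (h + 1) * M r (h - 1))
    (r h : ℕ) :
    M r h = if Even (r + h) then -(-1) ^ ((r + h) / 2) * brFactorial p q h *
      zigSum p q 1 (r + 1) (h + 1) else 0 := by
  induction r generalizing h with
  | zero =>
    rw [h0, zigSum, zigSum, zigSum]
    rcases h with _ | h <;> simp [brFactorial]
  | succ r ih =>
    have hz : zigSum p q 1 (r + 1 + 1) (h + 1) = br p q (h + 1) * zigSum p q 1 (r + 1) (h + 2) +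
        br p q (h + 1) * zigSum p q 1 (r + 1) h := by
      rw [zigSum, Nat.add_sub_cancel, Nat.add_sub_cancel]
    have e1 : r + (h + 1) = r + 1 + h := by ring
    rw [hs, ih, ih, hz, e1]
    rcases h with _ | h
    -- At the bottom, the down term of `zigSum` reaches height `0`, where for `d = 1` both weights
    -- vanish.
    · have := zigSum_one_succ_zero p q r
      split_ifs <;> simp [brFactorial, this]
    · have e2 : r + 1 + (h + 1) = r + h + 2 := by ring
      have e3 : Even (r + h + 2) ↔ Even (r + h) := by simp [parity_simps]
      rw [e2, Nat.add_sub_cancel, show (r + h + 2) / 2 = (r + h) / 2 + 1 by omega]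
      simp only [e3]
      split_ifs
      · rw [brFactorial_succ p q (h + 1), brFactorial_succ]
        ring
      · ring

lemma diagSum_eq_sum (n : ℕ) :
    diagSum p q y z n 0 =
      ∑ σ : Equiv.Perm (Fin n), y ^ wex σ * z ^ fixFrom 0 σ * p ^ nest σ * q ^ cros σ := by
  rw [diagSum, permSum]
  refine Finset.sum_congr rfl fun σ _ => if_pos fun i hi => ?_
  omega

lemma sum_perm_eq_zigSum (n : ℕ) (hn : 1 ≤ n) :
    ∑ σ : Equiv.Perm (Fin n), (-1 : R) ^ wex σ * p ^ nest σ * q ^ cros σ =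
      if Even n then 0 else (-1 : R) ^ ((n + 1) / 2) * zigSum p q 1 n 1 := by
  obtain ⟨r, rfl⟩ : ∃ r, n = r + 1 := ⟨n - 1, by omega⟩
  have h1 := diagSum_eq_sum p q (-1) 1 (r + 1)
  simp only [one_pow, mul_one] at h1
  rw [← h1, diagSum_succ_eq_oldSum, br_zero, zero_mul, add_zero,
    eq_zigSum_one p q _ (oldSum_neg_one_zero p q) (oldSum_neg_one_succ p q) r 0, Nat.add_zero]
  have : Even (r + 1) ↔ ¬ Even r := Nat.even_add_one
  by_cases hr : Even r
  · rw [if_pos hr, if_neg (by tauto), show (r + 1 + 1) / 2 = r / 2 + 1 by omega]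
    simp [brFactorial]
    ring
  · rw [if_neg hr, if_pos (by tauto)]

lemma sum_derangements_eq_zigSum (q : Rˣ) (n : ℕ) :
    ∑ σ : derangements (Fin n), (-((q⁻¹ : Rˣ) : R)) ^ exc σ.val * p ^ nest σ.val *
        (q : R) ^ cros σ.val =
      if Even n then (-((q⁻¹ : Rˣ) : R)) ^ (n / 2) * zigSum p (q : R) 0 n 0 else 0 := by
  set u : R := -((q⁻¹ : Rˣ) : R) with hu
  have huq : u * q = -1 := by simp [hu]
  have h1 : ∑ σ : derangements (Fin n), u ^ exc σ.val * p ^ nest σ.val * (q : R) ^ cros σ.val =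
      diagSum p q u 0 n 0 := by
    -- Setting `z = 0` kills exactly the permutations with a fixed point; on the others weak
    -- excedances are excedances.
    rw [diagSum_eq_sum, ← Finset.sum_subset (Finset.subset_univ
      (Finset.univ.filter fun σ : Equiv.Perm (Fin n) => σ ∈ derangements (Fin n)))]
    · rw [Finset.sum_subtype (p := fun σ => σ ∈ derangements (Fin n)) _ (by simp)]
      refine Finset.sum_congr rfl fun σ _ => ?_
      have h2 : fixFrom 0 σ.val = 0 := by
        rw [fixFrom, Finset.card_eq_zero, Finset.filter_eq_empty_iff]
        exact fun i _ hi => σ.2 i hi.2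
      have h3 : wex σ.val = exc σ.val := by
        rw [wex, exc]
        congr 1
        refine Finset.filter_congr fun i _ => ?_
        exact ⟨fun h => lt_of_le_of_ne h (Ne.symm (σ.2 i)), le_of_lt⟩
      rw [h2, h3, pow_zero, mul_one]
    · intro σ _ hσ
      have h2 : fixFrom 0 σ ≠ 0 := by
        intro h
        rw [fixFrom, Finset.card_eq_zero, Finset.filter_eq_empty_iff] at h
        exact hσ (Finset.mem_filter.mpr ⟨Finset.mem_univ _,
          fun i hi => h (Finset.mem_univ i) ⟨Nat.zero_le _, hi⟩⟩)
      rw [zero_pow h2]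
      ring
  rw [h1, eq_zigSum_zero p q u _ (diagSum_zero p q u 0) ?_ n 0, Nat.add_zero]
  · simp [brFactorial]
  · intro r h
    rw [diagSum_succ, br_mul_diagSum_pred]
    -- The level terms `u * q * br` and `br` cancel because `u * q = -1`.
    linear_combination br p (q : R) h * diagSum p q u 0 r h * huq

end Recurrences

end PermStat

namespace PermStat

open Finset

/-! ### (p,q)-integers as generating functions of ranks. -/

section Ranks

variable {R : Type*} [CommRing R] (p q : R)

lemma sum_rank {m : ℕ} (Z : Finset (Fin m)) :
    ∑ j ∈ Z, q ^ #{i ∈ Z | i < j} * p ^ #{i ∈ Z | j < i} = br p q #Z := by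
  induction Z using Finset.induction_on_min with
  | empty => simp
  | insert a s ha ih =>
    have hs : a ∉ s := fun h => lt_irrefl _ (ha a h)
    rw [Finset.sum_insert hs, Finset.card_insert_of_notMem hs, br_succ, ← ih, Finset.mul_sum,
      add_comm]
    congr 1
    · refine Finset.sum_congr rfl fun j hj => ?_
      rw [Finset.filter_insert, Finset.filter_insert, if_pos (ha j hj),
        if_neg (not_lt.mpr (ha j hj).le), Finset.card_insert_of_notMem (by simp [hs])]
      ring
    · rw [Finset.filter_insert, Finset.filter_insert, if_neg (lt_irrefl a),
        Finset.filter_eq_empty_iff.mpr (fun x hx => not_lt.mpr (ha x hx).le),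
        Finset.filter_eq_self.mpr ha]
      simp

/-- The forced last element lies to the right of every other one, so the `- 1` in the exponent of
`p` is exactly the effect of erasing it from `Z`. -/
lemma sum_rank_erase_last {m : ℕ} (Z : Finset (Fin m)) (hZ : ∀ i : Fin m, i.val + 1 = m → i ∈ Z) :
    ∑ j ∈ Z with j.val + 1 ≠ m, q ^ #{i ∈ Z | i < j} * p ^ (#{i ∈ Z | j < i} - 1) =
      br p q (#Z - 1) := by
  rcases m with _ | m
  · simp [Finset.eq_empty_of_isEmpty Z]
  · have hl : Fin.last m ∈ Z := hZ _ (by simp)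
    have he : Z.filter (fun j => j.val + 1 ≠ m + 1) = Z.erase (Fin.last m) := by
      ext j
      simp [Fin.ext_iff, and_comm]
    rw [he, ← Finset.card_erase_of_mem hl, ← sum_rank]
    refine Finset.sum_congr rfl fun j hj => ?_
    have hj' : j < Fin.last m := lt_of_le_of_ne (Fin.le_last j) (Finset.ne_of_mem_erase hj)
    rw [Finset.filter_erase, Finset.filter_erase,
      Finset.card_erase_of_mem (Finset.mem_filter.mpr ⟨hl, hj'⟩),
      Finset.erase_eq_of_notMem (a := Fin.last m) (s := Z.filter (· < j))
        (fun h => (Fin.le_last j).not_gt (Finset.mem_filter.mp h).2)]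

lemma sum_gap {m : ℕ} (Z : Finset (Fin m)) :
    ∑ g : Fin (m + 1) with ∀ k : Fin m, k.val + 1 = g.val → k ∈ Z,
      q ^ #{k ∈ Z | k.castSucc < g} * p ^ #{k ∈ Z | g ≤ k.castSucc} = br p q (#Z + 1) := by
  -- The admissible gaps are the front and those directly behind an element of `Z`, one more than
  -- the size of `Z`.
  have he : (Finset.univ.filter fun g : Fin (m + 1) => ∀ k : Fin m, k.val + 1 = g.val → k ∈ Z) =
      insert 0 (Z.map (Fin.succEmb m)) := by
    ext g
    refine Fin.cases ?_ (fun a => ?_) g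
    · simp
    · simp only [Finset.mem_filter, Finset.mem_univ, true_and, Finset.mem_insert,
        Fin.succ_ne_zero, false_or, Finset.mem_map, Fin.coe_succEmb, Fin.succ_inj,
        exists_eq_right, Fin.val_succ, Nat.add_right_cancel_iff]
      exact ⟨fun h => h a rfl, fun h k hk => by rwa [Fin.ext hk]⟩
  rw [he, Finset.sum_insert (by simp [Fin.succ_ne_zero]), Finset.sum_map, br_succ, ← sum_rank,
    Finset.mul_sum, add_comm]
  congr 1
  · refine Finset.sum_congr rfl fun a ha => ?_
    have h1 : Z.filter (fun k => k.castSucc < (Fin.succEmb m) a) =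
        insert a (Z.filter fun k => k < a) := by
      ext k
      simp only [Finset.mem_filter, Fin.coe_succEmb, Finset.mem_insert, Fin.lt_def,
        Fin.val_castSucc, Fin.val_succ, Fin.ext_iff]
      constructor
      · rintro ⟨hk, h⟩
        by_cases hka : k.val = a.val
        · exact Or.inl hka
        · exact Or.inr ⟨hk, by omega⟩
      · rintro (h | ⟨hk, h⟩)
        · exact ⟨by rwa [Fin.ext h], by omega⟩
        · exact ⟨hk, by omega⟩
    have h2 : Z.filter (fun k => (Fin.succEmb m) a ≤ k.castSucc) = Z.filter fun k => a < k := by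
      refine Finset.filter_congr fun k _ => ?_
      simp only [Fin.coe_succEmb, Fin.lt_def, Fin.le_def, Fin.val_castSucc, Fin.val_succ]
      omega
    rw [h1, h2, Finset.card_insert_of_notMem (by simp)]
    ring
  · simp

end Ranks

/-! ### Partially erased alternating words and the two ways to add a value. -/

section Words

variable {n m : ℕ}

/-- A partially erased falling alternating word, recorded as its sequence of pairs of a peak and
the following valley: the values below `t` have been removed or replaced by the valley `0`, all
others occur exactly once. For `d = 1` the last valley has to be `0`. -/
structure IsZig (d t : ℕ) (w : Fin m → Fin (n + 1) × Fin (n + 1)) : Prop where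
  exists_eq : ∀ v : Fin (n + 1), t ≤ v.val → ∃ i, (w i).1 = v ∨ (w i).2 = v
  le_peak : ∀ i, t ≤ (w i).1.val
  valley : ∀ i, (w i).2.val = 0 ∨ t ≤ (w i).2.val
  peak_inj : ∀ i j, (w i).1 = (w j).1 → i = j
  valley_inj : ∀ i j, (w i).2 = (w j).2 → (w i).2.val ≠ 0 → i = j
  peak_ne : ∀ i j, (w i).1 ≠ (w j).2
  desc : ∀ i, (w i).2 < (w i).1
  asc : ∀ i j : Fin m, i.val + 1 = j.val → (w i).2 < (w j).1
  last : d = 1 → ∀ i : Fin m, i.val + 1 = m → (w i).2.val = 0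

/-- The positions of the erased valleys. -/
def zeros (w : Fin m → Fin (n + 1) × Fin (n + 1)) : Finset (Fin m) :=
  Finset.univ.filter fun i => (w i).2.val = 0

lemma mem_zeros {w : Fin m → Fin (n + 1) × Fin (n + 1)} {i : Fin m} :
    i ∈ zeros w ↔ (w i).2.val = 0 := by
  simp [zeros]

/-- The number of pairs to the left of `i` straddling the value `x`. -/
def lft (w : Fin m → Fin (n + 1) × Fin (n + 1)) (i : Fin m) (x : Fin (n + 1)) : ℕ :=
  #{j | j < i ∧ (w j).2 < x ∧ x < (w j).1}

/-- The number of pairs to the right of `i` straddling the value `x`. -/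
def rgt (w : Fin m → Fin (n + 1) × Fin (n + 1)) (i : Fin m) (x : Fin (n + 1)) : ℕ :=
  #{j | i < j ∧ (w j).2 < x ∧ x < (w j).1}

/-- The `n + 1 - t` remaining values fill the `m` peaks and the nonzero valleys, each once. Hence
the number of zeros, the height of the path, is determined by `m` and `t`. -/
lemma card_zeros {d t : ℕ} (ht : 1 ≤ t) {w : Fin m → Fin (n + 1) × Fin (n + 1)}
    (hw : IsZig d t w) : #(zeros w) + (n + 1 - t) = 2 * m := by
  have h1 : (Finset.univ.filter fun v : Fin (n + 1) => t ≤ v.val) =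
      (Finset.univ.image fun i => (w i).1) ∪
        (Finset.univ.filter fun i => ¬ (w i).2.val = 0).image fun i => (w i).2 := by
    ext v
    simp only [Finset.mem_filter, Finset.mem_univ, true_and, Finset.mem_union, Finset.mem_image]
    constructor
    · intro hv
      obtain ⟨i, hi | hi⟩ := hw.exists_eq v hv
      · exact Or.inl ⟨i, hi⟩
      · exact Or.inr ⟨i, by rw [hi]; omega, hi⟩
    · rintro (⟨i, rfl⟩ | ⟨i, hi, rfl⟩)
      · exact hw.le_peak i
      · exact (hw.valley i).resolve_left hi
  have h2 : #(Finset.univ.filter fun v : Fin (n + 1) => t ≤ v.val) = n + 1 - t := by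
    have := sum_interval_indicator (N := n + 1) t (n + 1) le_rfl
    rw [Finset.card_filter, ← this]
    exact Finset.sum_congr rfl fun k _ => if_congr (by omega) rfl rfl
  rw [← h2, h1, Finset.card_union_of_disjoint, Finset.card_image_of_injective,
    Finset.card_image_of_injOn, Finset.card_univ, Fintype.card_fin]
  · have := Finset.card_filter_add_card_filter_not (s := (Finset.univ : Finset (Fin m)))
      (fun i => (w i).2.val = 0)
    rw [Finset.card_univ, Fintype.card_fin] at this
    rw [zeros]
    omega
  · intro i hi j _ hij
    exact hw.valley_inj i j hij (by simpa using hi)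
  · exact fun i j hij => hw.peak_inj i j hij
  · rw [Finset.disjoint_left]
    rintro v h3 h4
    simp only [Finset.mem_filter, Finset.mem_univ, true_and, Finset.mem_image] at h3 h4
    obtain ⟨i, rfl⟩ := h3
    obtain ⟨j, -, hj⟩ := h4
    exact hw.peak_ne i j hj.symm

/-- All remaining values exceed `x`, so a pair straddles `x` exactly when its valley is erased. -/
lemma IsZig.lft_eq {d t : ℕ} {w : Fin m → Fin (n + 1) × Fin (n + 1)}
    (hw : IsZig d (t + 1) w) {x : Fin (n + 1)} (hx : x.val = t) (ht : 1 ≤ t) (i : Fin m) :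
    lft w i x = #{j ∈ zeros w | j < i} := by
  rw [lft, zeros, Finset.filter_filter]
  congr 1
  refine Finset.filter_congr fun j _ => ?_
  have h1 := hw.le_peak j
  have h2 := hw.valley j
  rw [Fin.lt_def, Fin.lt_def, Fin.lt_def]
  omega

lemma IsZig.rgt_eq {d t : ℕ} {w : Fin m → Fin (n + 1) × Fin (n + 1)}
    (hw : IsZig d (t + 1) w) {x : Fin (n + 1)} (hx : x.val = t) (ht : 1 ≤ t) (i : Fin m) :
    rgt w i x = #{j ∈ zeros w | i < j} := by
  rw [rgt, zeros, Finset.filter_filter]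
  congr 1
  refine Finset.filter_congr fun j _ => ?_
  have h1 := hw.le_peak j
  have h2 := hw.valley j
  rw [Fin.lt_def, Fin.lt_def, Fin.lt_def]
  omega

/-- `w` arises from `w'` by writing the value `x` into the valley `j`, which is `0` in `w'`. -/
structure FillValley (x : Fin (n + 1)) (j : Fin m)
    (w w' : Fin m → Fin (n + 1) × Fin (n + 1)) : Prop where
  peak : ∀ i, (w i).1 = (w' i).1
  valley : ∀ i, i ≠ j → (w i).2 = (w' i).2
  new : (w j).2 = x
  old : (w' j).2.val = 0

lemma FillValley.isZig {x : Fin (n + 1)} {j : Fin m} {w w' : Fin m → Fin (n + 1) × Fin (n + 1)}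
    (H : FillValley x j w w') {d : ℕ} (hx : 1 ≤ x.val) (hw : IsZig d (x.val + 1) w')
    (hj : d = 1 → j.val + 1 ≠ m) : IsZig d x.val w where
  exists_eq v hv := by
    rcases hv.eq_or_lt with h | h
    · exact ⟨j, Or.inr (by rw [H.new]; exact Fin.ext h)⟩
    · obtain ⟨i, hi | hi⟩ := hw.exists_eq v h
      · exact ⟨i, Or.inl (by rw [H.peak, hi])⟩
      · refine ⟨i, Or.inr ?_⟩
        rw [H.valley, hi]
        rintro rfl
        have := H.old
        rw [hi] at this
        omega
  le_peak i := by
    rw [H.peak]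
    have := hw.le_peak i
    omega
  valley i := by
    by_cases hi : i = j
    · rw [hi, H.new]
      exact Or.inr le_rfl
    · rw [H.valley i hi]
      have := hw.valley i
      omega
  peak_inj i k h := hw.peak_inj i k (by rwa [H.peak, H.peak] at h)
  valley_inj i k h h0 := by
    have h1 := hw.valley i
    have h2 := hw.valley k
    by_cases hi : i = j <;> by_cases hk : k = j
    · rw [hi, hk]
    · rw [hi, H.new, H.valley k hk] at h
      rw [← h] at h2
      omega
    · rw [hk, H.new, H.valley i hi] at h
      rw [h] at h1
      omega
    · rw [H.valley i hi, H.valley k hk] at h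
      rw [H.valley i hi] at h0
      exact hw.valley_inj i k h h0
  peak_ne i k := by
    rw [H.peak]
    by_cases hk : k = j
    · have := hw.le_peak i
      rw [hk, H.new]
      rintro h
      rw [h] at this
      omega
    · rw [H.valley k hk]
      exact hw.peak_ne i k
  desc i := by
    by_cases hi : i = j
    · have := hw.le_peak i
      rw [H.peak, hi, H.new, Fin.lt_def, ← hi]
      omega
    · rw [H.peak, H.valley i hi]
      exact hw.desc i
  asc i k hik := by
    by_cases hi : i = j
    · have := hw.le_peak k
      rw [H.peak, hi, H.new, Fin.lt_def]
      omega
    · rw [H.peak, H.valley i hi]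
      exact hw.asc i k hik
  last hd i hi := by
    rw [H.valley i (by rintro rfl; exact hj hd hi)]
    exact hw.last hd i hi

lemma FillValley.isZig_old {x : Fin (n + 1)} {j : Fin m}
    {w w' : Fin m → Fin (n + 1) × Fin (n + 1)} (H : FillValley x j w w') {d : ℕ}
    (hx : 1 ≤ x.val) (hw : IsZig d x.val w) :
    IsZig d (x.val + 1) w' ∧ (d = 1 → j.val + 1 ≠ m) := by
  have hold := H.old
  have hne : ∀ i, i ≠ j → (w i).2 ≠ x := fun i hi h =>
    hi (hw.valley_inj i j (by rw [h, H.new]) (by rw [h]; omega))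
  refine ⟨⟨fun v hv => ?_, fun i => ?_, fun i => ?_, fun i k h => ?_, fun i k h h0 => ?_,
    fun i k => ?_, fun i => ?_, fun i k hik => ?_, fun hd i hi => ?_⟩, fun hd hj => ?_⟩
  · obtain ⟨i, hi | hi⟩ := hw.exists_eq v (by omega)
    · exact ⟨i, Or.inl (by rw [← H.peak, hi])⟩
    · refine ⟨i, Or.inr ?_⟩
      rw [← H.valley, hi]
      rintro rfl
      rw [H.new] at hi
      rw [hi] at hv
      omega
  · have h1 := hw.le_peak i
    have h2 := hw.peak_ne i j
    rw [H.new, Ne, Fin.ext_iff] at h2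
    rw [← H.peak]
    omega
  · by_cases hi : i = j
    · rw [hi]
      exact Or.inl H.old
    · have h1 := hw.valley i
      have h2 := hne i hi
      rw [Ne, Fin.ext_iff] at h2
      rw [← H.valley i hi]
      omega
  · exact hw.peak_inj i k (by rwa [H.peak, H.peak])
  · by_cases hi : i = j
    · rw [hi] at h0
      exact absurd H.old h0
    · by_cases hk : k = j
      · rw [h, hk] at h0
        exact absurd H.old h0
      · rw [← H.valley i hi, ← H.valley k hk] at h
        rw [← H.valley i hi] at h0
        exact hw.valley_inj i k h h0
  · rw [← H.peak]
    by_cases hk : k = j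
    · have := hw.le_peak i
      rw [hk, Ne, Fin.ext_iff]
      omega
    · rw [← H.valley k hk]
      exact hw.peak_ne i k
  · rw [← H.peak]
    by_cases hi : i = j
    · have := hw.le_peak i
      rw [hi, Fin.lt_def, ← hi, hi, hold, ← hi]
      omega
    · rw [← H.valley i hi]
      exact hw.desc i
  · rw [← H.peak]
    by_cases hi : i = j
    · have := hw.le_peak k
      rw [hi, Fin.lt_def, hold]
      omega
    · rw [← H.valley i hi]
      exact hw.asc i k hik
  · by_cases hij : i = j
    · rw [hij]
      exact H.old
    · rw [← H.valley i hij]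
      exact hw.last hd i hi
  · have := hw.last hd j hj
    rw [H.new] at this
    omega

/-- Larger values cannot distinguish a valley `0` from a valley `x`, so the weights already
collected are unaffected. -/
lemma FillValley.straddle {x : Fin (n + 1)} {j : Fin m}
    {w w' : Fin m → Fin (n + 1) × Fin (n + 1)} (H : FillValley x j w w')
    {y : Fin (n + 1)} (hy : x < y) (i : Fin m) :
    ((w i).2 < y ∧ y < (w i).1) ↔ ((w' i).2 < y ∧ y < (w' i).1) := by
  rw [H.peak]
  by_cases hi : i = j
  · have := H.old
    rw [Fin.lt_def] at hy
    rw [hi, H.new, Fin.lt_def, Fin.lt_def, Fin.lt_def]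
    omega
  · rw [H.valley i hi]

/-- `w` arises from `w'` by inserting the pair `(x, 0)` at the index `g`. -/
structure InsertPeak (x : Fin (n + 1)) (g : Fin (m + 1))
    (w : Fin (m + 1) → Fin (n + 1) × Fin (n + 1)) (w' : Fin m → Fin (n + 1) × Fin (n + 1)) :
    Prop where
  new : w g = (x, 0)
  old : ∀ k, w (g.succAbove k) = w' k

lemma InsertPeak.isZig {x : Fin (n + 1)} {g : Fin (m + 1)}
    {w : Fin (m + 1) → Fin (n + 1) × Fin (n + 1)} {w' : Fin m → Fin (n + 1) × Fin (n + 1)}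
    (H : InsertPeak x g w w') {d : ℕ} (hx : 1 ≤ x.val) (hw : IsZig d (x.val + 1) w')
    (hg : ∀ k : Fin m, k.val + 1 = g.val → k ∈ zeros w') : IsZig d x.val w where
  exists_eq v hv := by
    rcases hv.eq_or_lt with h | h
    · exact ⟨g, Or.inl (by rw [H.new]; exact Fin.ext h)⟩
    · obtain ⟨i, hi⟩ := hw.exists_eq v h
      exact ⟨g.succAbove i, by rwa [H.old]⟩
  le_peak i := by
    obtain rfl | ⟨k, rfl⟩ := Fin.eq_self_or_eq_succAbove g i
    · rw [H.new]
    · rw [H.old]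
      have := hw.le_peak k
      omega
  valley i := by
    obtain rfl | ⟨k, rfl⟩ := Fin.eq_self_or_eq_succAbove g i
    · rw [H.new]
      simp
    · rw [H.old]
      have := hw.valley k
      omega
  peak_inj i j h := by
    rcases Fin.eq_self_or_eq_succAbove g i with hi | ⟨k, rfl⟩ <;>
      rcases Fin.eq_self_or_eq_succAbove g j with hj | ⟨l, rfl⟩
    · rw [hi, hj]
    · rw [hi, H.new, H.old] at h
      have := hw.le_peak l
      simp only at h
      rw [← h] at this
      omega
    · rw [hj, H.new, H.old] at h
      have := hw.le_peak k
      simp only at h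
      rw [h] at this
      omega
    · rw [H.old, H.old] at h
      rw [hw.peak_inj k l h]
  valley_inj i j h h0 := by
    obtain rfl | ⟨k, rfl⟩ := Fin.eq_self_or_eq_succAbove g i
    · rw [H.new] at h0
      simp at h0
    · obtain rfl | ⟨l, rfl⟩ := Fin.eq_self_or_eq_succAbove g j
      · rw [h, H.new] at h0
        simp at h0
      · rw [H.old, H.old] at h
        rw [H.old] at h0
        rw [hw.valley_inj k l h h0]
  peak_ne i j := by
    rcases Fin.eq_self_or_eq_succAbove g i with hi | ⟨k, rfl⟩ <;>
      rcases Fin.eq_self_or_eq_succAbove g j with hj | ⟨l, rfl⟩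
    · rw [hi, hj, H.new, Ne, Fin.ext_iff]
      simp only [Fin.val_zero]
      omega
    · have := hw.valley l
      rw [hi, H.new, H.old, Ne, Fin.ext_iff]
      simp only
      omega
    · have := hw.le_peak k
      rw [hj, H.new, H.old, Ne, Fin.ext_iff]
      simp only [Fin.val_zero]
      omega
    · rw [H.old, H.old]
      exact hw.peak_ne k l
  desc i := by
    obtain rfl | ⟨k, rfl⟩ := Fin.eq_self_or_eq_succAbove g i
    · rw [H.new, Fin.lt_def]
      simp only [Fin.val_zero]
      omega
    · rw [H.old]
      exact hw.desc k
  asc i j hij := by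
    rcases Fin.eq_self_or_eq_succAbove g i with hi | ⟨k, rfl⟩ <;>
      rcases Fin.eq_self_or_eq_succAbove g j with hj | ⟨l, rfl⟩
    · omega
    · have := hw.le_peak l
      rw [hi, H.new, H.old, Fin.lt_def]
      simp only [Fin.val_zero]
      omega
    · have h1 := succAbove_val_cases g k
      have h2 := mem_zeros.mp (hg k (by omega))
      rw [hj, H.new, H.old, Fin.lt_def]
      simp only
      omega
    · have h1 := succAbove_val_cases g k
      have h2 := succAbove_val_cases g l
      rw [H.old, H.old]
      exact hw.asc k l (by omega)
  last hd i hi := by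
    obtain rfl | ⟨k, rfl⟩ := Fin.eq_self_or_eq_succAbove g i
    · simp [H.new]
    · rw [H.old]
      have h1 := succAbove_val_cases g k
      by_cases hk : k.val + 1 = m
      · exact hw.last hd k hk
      · omega

lemma InsertPeak.isZig_old {x : Fin (n + 1)} {g : Fin (m + 1)}
    {w : Fin (m + 1) → Fin (n + 1) × Fin (n + 1)} {w' : Fin m → Fin (n + 1) × Fin (n + 1)}
    (H : InsertPeak x g w w') {d : ℕ} (hx : 1 ≤ x.val) (hw : IsZig d x.val w) :
    IsZig d (x.val + 1) w' ∧ (∀ k : Fin m, k.val + 1 = g.val → k ∈ zeros w') := by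
  -- The valley before the peak `x` is smaller than `x`, the least remaining value, so it is erased.
  have hgap : ∀ k : Fin m, k.val + 1 = g.val → (w' k).2.val = 0 := by
    intro k hk
    have h1 := succAbove_val_cases g k
    have h2 := hw.asc (g.succAbove k) g (by omega)
    have h3 := hw.valley (g.succAbove k)
    rw [H.old, H.new, Fin.lt_def] at h2
    rw [H.old] at h3
    simp only at h2
    omega
  have hpeak : ∀ k, x.val + 1 ≤ (w' k).1.val := by
    intro k
    have h1 := hw.le_peak (g.succAbove k)
    have h2 : (w (g.succAbove k)).1 ≠ (w g).1 := fun h =>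
      Fin.succAbove_ne g k (hw.peak_inj _ _ h)
    rw [H.old, H.new, Ne, Fin.ext_iff] at h2
    rw [H.old] at h1
    simp only at h2
    omega
  refine ⟨⟨fun v hv => ?_, hpeak, fun i => ?_, fun i k h => ?_, fun i k h h0 => ?_,
    fun i k => ?_, fun i => ?_, fun i k hik => ?_, fun hd i hi => ?_⟩,
    fun k hk => mem_zeros.mpr (hgap k hk)⟩
  · obtain ⟨i, hi⟩ := hw.exists_eq v (by omega)
    obtain rfl | ⟨k, rfl⟩ := Fin.eq_self_or_eq_succAbove g i
    · rw [H.new, Fin.ext_iff, Fin.ext_iff] at hi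
      simp only [Fin.val_zero] at hi
      omega
    · exact ⟨k, by rwa [H.old] at hi⟩
  · have h1 := hw.valley (g.succAbove i)
    have h2 := hw.peak_ne g (g.succAbove i)
    rw [H.old] at h1
    rw [H.old, H.new, Ne, Fin.ext_iff] at h2
    simp only at h2
    omega
  · have := hw.peak_inj (g.succAbove i) (g.succAbove k) (by rwa [H.old, H.old])
    exact Fin.succAbove_right_injective this
  · have := hw.valley_inj (g.succAbove i) (g.succAbove k) (by rwa [H.old, H.old])
      (by rwa [H.old])
    exact Fin.succAbove_right_injective this
  · have := hw.peak_ne (g.succAbove i) (g.succAbove k)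
    rwa [H.old, H.old] at this
  · have := hw.desc (g.succAbove i)
    rwa [H.old] at this
  · have h1 := succAbove_val_cases g i
    have h2 := succAbove_val_cases g k
    by_cases hg : i.val + 1 = g.val
    · have h3 := hgap i hg
      have h4 := hpeak k
      rw [Fin.lt_def]
      omega
    · have := hw.asc (g.succAbove i) (g.succAbove k) (by omega)
      rwa [H.old, H.old] at this
  · by_cases hg : i.val + 1 = g.val
    · exact hgap i hg
    · have h1 := succAbove_val_cases g i
      have := hw.last hd (g.succAbove i) (by omega)
      rwa [H.old] at this

end Words

end PermStat

namespace PermStat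

open Finset

/-! ### The recurrence for weighted sums over words. -/

section WordSums

variable {R : Type*} [CommRing R] (p q : R) {n m : ℕ}

/-- The weight of a partially erased alternating word. -/
def wordWeight (d : ℕ) (w : Fin m → Fin (n + 1) × Fin (n + 1)) : R :=
  ∏ i, (q ^ lft w i (w i).1 * p ^ rgt w i (w i).1 *
    if (w i).2.val = 0 then 1 else q ^ lft w i (w i).2 * p ^ (rgt w i (w i).2 - d))

lemma FillValley.lft_eq {x : Fin (n + 1)} {j : Fin m}
    {w w' : Fin m → Fin (n + 1) × Fin (n + 1)} (H : FillValley x j w w')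
    {y : Fin (n + 1)} (hy : x < y) (i : Fin m) : lft w i y = lft w' i y := by
  rw [lft, lft]
  simp only [H.straddle hy]

lemma FillValley.rgt_eq {x : Fin (n + 1)} {j : Fin m}
    {w w' : Fin m → Fin (n + 1) × Fin (n + 1)} (H : FillValley x j w w')
    {y : Fin (n + 1)} (hy : x < y) (i : Fin m) : rgt w i y = rgt w' i y := by
  rw [rgt, rgt]
  simp only [H.straddle hy]

lemma FillValley.lft_new {x : Fin (n + 1)} {j : Fin m}
    {w w' : Fin m → Fin (n + 1) × Fin (n + 1)} (H : FillValley x j w w') :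
    lft w j x = lft w' j x := by
  rw [lft, lft]
  congr 1
  refine Finset.filter_congr fun k _ => and_congr_right fun hk => ?_
  rw [H.peak, H.valley k hk.ne]

lemma FillValley.rgt_new {x : Fin (n + 1)} {j : Fin m}
    {w w' : Fin m → Fin (n + 1) × Fin (n + 1)} (H : FillValley x j w w') :
    rgt w j x = rgt w' j x := by
  rw [rgt, rgt]
  congr 1
  refine Finset.filter_congr fun k _ => and_congr_right fun hk => ?_
  rw [H.peak, H.valley k hk.ne']

lemma FillValley.wordWeight_eq {x : Fin (n + 1)} {j : Fin m}
    {w w' : Fin m → Fin (n + 1) × Fin (n + 1)} (H : FillValley x j w w') {d : ℕ}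
    (hx : 1 ≤ x.val) (hw : IsZig d (x.val + 1) w') :
    wordWeight p q d w = q ^ #{i ∈ zeros w' | i < j} * p ^ (#{i ∈ zeros w' | j < i} - d) *
      wordWeight p q d w' := by
  rw [← hw.lft_eq rfl hx, ← hw.rgt_eq rfl hx, ← H.lft_new, ← H.rgt_new, wordWeight, wordWeight,
    ← Finset.mul_prod_erase _ _ (Finset.mem_univ j),
    ← Finset.mul_prod_erase (a := j) _ (fun i => _ * _) (Finset.mem_univ j), ← mul_assoc]
  have hpk : ∀ i, x < (w' i).1 := fun i => Fin.lt_def.mpr (hw.le_peak i)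
  congr 1
  · rw [H.new, if_neg (by omega), if_pos H.old, H.peak, H.lft_eq (hpk j), H.rgt_eq (hpk j)]
    ring
  · refine Finset.prod_congr rfl fun i hi => ?_
    rw [H.peak, H.valley i (Finset.ne_of_mem_erase hi), H.lft_eq (hpk i), H.rgt_eq (hpk i)]
    congr 1
    split_ifs with h0
    · rfl
    · have hv : x < (w' i).2 := Fin.lt_def.mpr ((hw.valley i).resolve_left h0)
      rw [H.lft_eq hv, H.rgt_eq hv]

lemma InsertPeak.lft_eq {x : Fin (n + 1)} {g : Fin (m + 1)}
    {w : Fin (m + 1) → Fin (n + 1) × Fin (n + 1)} {w' : Fin m → Fin (n + 1) × Fin (n + 1)}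
    (H : InsertPeak x g w w') {y : Fin (n + 1)} (hy : x < y) (k : Fin m) :
    lft w (g.succAbove k) y = lft w' k y := by
  rw [lft, lft, Finset.card_filter, Finset.card_filter, Fin.sum_univ_succAbove _ g, H.new,
    if_neg (fun h => hy.not_gt h.2.2), zero_add]
  simp only [H.old, Fin.succAbove_lt_succAbove_iff]

lemma InsertPeak.rgt_eq {x : Fin (n + 1)} {g : Fin (m + 1)}
    {w : Fin (m + 1) → Fin (n + 1) × Fin (n + 1)} {w' : Fin m → Fin (n + 1) × Fin (n + 1)}
    (H : InsertPeak x g w w') {y : Fin (n + 1)} (hy : x < y) (k : Fin m) :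
    rgt w (g.succAbove k) y = rgt w' k y := by
  rw [rgt, rgt, Finset.card_filter, Finset.card_filter, Fin.sum_univ_succAbove _ g, H.new,
    if_neg (fun h => hy.not_gt h.2.2), zero_add]
  simp only [H.old, Fin.succAbove_lt_succAbove_iff]

lemma InsertPeak.lft_new {x : Fin (n + 1)} {g : Fin (m + 1)}
    {w : Fin (m + 1) → Fin (n + 1) × Fin (n + 1)} {w' : Fin m → Fin (n + 1) × Fin (n + 1)}
    (H : InsertPeak x g w w') {d : ℕ} (hx : 1 ≤ x.val) (hw : IsZig d (x.val + 1) w') :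
    lft w g x = #{k ∈ zeros w' | k.castSucc < g} := by
  rw [lft, zeros, Finset.filter_filter, Finset.card_filter, Finset.card_filter,
    Fin.sum_univ_succAbove _ g, if_neg (fun h => lt_irrefl _ h.1), zero_add]
  refine Finset.sum_congr rfl fun k _ => if_congr ?_ rfl rfl
  have h1 := hw.le_peak k
  have h2 := hw.valley k
  have h3 := succAbove_val_cases g k
  rw [H.old, Fin.lt_def, Fin.lt_def, Fin.lt_def, Fin.lt_def, Fin.val_castSucc]
  omega

lemma InsertPeak.rgt_new {x : Fin (n + 1)} {g : Fin (m + 1)}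
    {w : Fin (m + 1) → Fin (n + 1) × Fin (n + 1)} {w' : Fin m → Fin (n + 1) × Fin (n + 1)}
    (H : InsertPeak x g w w') {d : ℕ} (hx : 1 ≤ x.val) (hw : IsZig d (x.val + 1) w') :
    rgt w g x = #{k ∈ zeros w' | g ≤ k.castSucc} := by
  rw [rgt, zeros, Finset.filter_filter, Finset.card_filter, Finset.card_filter,
    Fin.sum_univ_succAbove _ g, if_neg (fun h => lt_irrefl _ h.1), zero_add]
  refine Finset.sum_congr rfl fun k _ => if_congr ?_ rfl rfl
  have h1 := hw.le_peak k
  have h2 := hw.valley k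
  have h3 := succAbove_val_cases g k
  rw [H.old, Fin.lt_def, Fin.lt_def, Fin.lt_def, Fin.le_def, Fin.val_castSucc]
  omega

lemma InsertPeak.wordWeight_eq {x : Fin (n + 1)} {g : Fin (m + 1)}
    {w : Fin (m + 1) → Fin (n + 1) × Fin (n + 1)} {w' : Fin m → Fin (n + 1) × Fin (n + 1)}
    (H : InsertPeak x g w w') {d : ℕ} (hx : 1 ≤ x.val) (hw : IsZig d (x.val + 1) w') :
    wordWeight p q d w = q ^ #{k ∈ zeros w' | k.castSucc < g} *
      p ^ #{k ∈ zeros w' | g ≤ k.castSucc} * wordWeight p q d w' := by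
  rw [← H.lft_new hx hw, ← H.rgt_new hx hw, wordWeight, wordWeight, Fin.prod_univ_succAbove _ g]
  congr 1
  · rw [H.new]
    simp
  · refine Finset.prod_congr rfl fun k _ => ?_
    have hp : x < (w' k).1 := Fin.lt_def.mpr (hw.le_peak k)
    rw [H.old, H.lft_eq hp, H.rgt_eq hp]
    congr 1
    split_ifs with h0
    · rfl
    · have hv : x < (w' k).2 := Fin.lt_def.mpr ((hw.valley k).resolve_left h0)
      rw [H.lft_eq hv, H.rgt_eq hv]

open Classical in
/-- The weighted sum over partially erased alternating words. -/
noncomputable def wordSum (n m d t : ℕ) : R :=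
  ∑ w : Fin m → Fin (n + 1) × Fin (n + 1) with IsZig d t w, wordWeight p q d w

lemma fillValley_update {x : Fin (n + 1)} {j : Fin m}
    {w' : Fin m → Fin (n + 1) × Fin (n + 1)} (h : j ∈ zeros w') :
    FillValley x j (Function.update w' j ((w' j).1, x)) w' where
  peak i := by
    by_cases hi : i = j
    · subst hi
      simp
    · simp [hi]
  valley i hi := by simp [hi]
  new := by simp
  old := mem_zeros.mp h

lemma insertPeak_insertNth (x : Fin (n + 1)) (g : Fin (m + 1))
    (w' : Fin m → Fin (n + 1) × Fin (n + 1)) :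
    InsertPeak x g (g.insertNth (α := fun _ => Fin (n + 1) × Fin (n + 1)) (x, 0) w') w' where
  new := by simp
  old k := by simp

lemma FillValley.unique {x : Fin (n + 1)} {j j' : Fin m}
    {w w₁ w₂ : Fin m → Fin (n + 1) × Fin (n + 1)} (H₁ : FillValley x j w w₁)
    (H₂ : FillValley x j' w w₂) {d : ℕ} (hx : 1 ≤ x.val) (hw : IsZig d x.val w) :
    w₁ = w₂ ∧ j = j' := by
  obtain rfl : j = j' := hw.valley_inj _ _ (by rw [H₁.new, H₂.new]) (by rw [H₁.new]; omega)
  refine ⟨funext fun i => Prod.ext (by rw [← H₁.peak, ← H₂.peak]) ?_, rfl⟩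
  by_cases hi : i = j
  · rw [hi]
    exact Fin.ext (by rw [H₁.old, H₂.old])
  · rw [← H₁.valley i hi, ← H₂.valley i hi]

lemma InsertPeak.unique {x : Fin (n + 1)} {g g' : Fin (m + 1)}
    {w : Fin (m + 1) → Fin (n + 1) × Fin (n + 1)} {w₁ w₂ : Fin m → Fin (n + 1) × Fin (n + 1)}
    (H₁ : InsertPeak x g w w₁) (H₂ : InsertPeak x g' w w₂) {d : ℕ} (hw : IsZig d x.val w) :
    w₁ = w₂ ∧ g = g' := by
  obtain rfl : g = g' := hw.peak_inj _ _ (by rw [H₁.new, H₂.new])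
  exact ⟨funext fun i => by rw [← H₁.old, ← H₂.old], rfl⟩

open Classical in
-- Erasing the valley `x` is inverse to filling a zero of `w'`; the final zero is reserved when `d =
-- 1`, which leaves `#(zeros w') - d` choices, weighted by rank.
lemma sum_valley (d t : ℕ) (hd : d ≤ 1) (ht : 1 ≤ t) (x : Fin (n + 1)) (hx : x.val = t) :
    ∑ w : Fin m → Fin (n + 1) × Fin (n + 1) with IsZig d t w ∧ ∃ j, (w j).2 = x,
        wordWeight p q d w =
      ∑ w' : Fin m → Fin (n + 1) × Fin (n + 1) with IsZig d (t + 1) w',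
        br p q (#(zeros w') - d) * wordWeight p q d w' := by
  subst hx
  have hbr : ∀ w' : Fin m → Fin (n + 1) × Fin (n + 1), IsZig d (x.val + 1) w' →
      br p q (#(zeros w') - d) * wordWeight p q d w' =
        ∑ j ∈ (zeros w').filter (fun j => d = 1 → j.val + 1 ≠ m),
          wordWeight p q d (Function.update w' j ((w' j).1, x)) := by
    intro w' hw'
    have h1 : br p q (#(zeros w') - d) = ∑ j ∈ (zeros w').filter (fun j => d = 1 → j.val + 1 ≠ m),
        q ^ #{i ∈ zeros w' | i < j} * p ^ (#{i ∈ zeros w' | j < i} - d) := by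
      interval_cases d
      · simp [sum_rank]
      · rw [← sum_rank_erase_last]
        · simp
        · exact fun i hi => mem_zeros.mpr (hw'.last rfl i hi)
    rw [h1, Finset.sum_mul]
    refine Finset.sum_congr rfl fun j hj => ?_
    exact ((fillValley_update (Finset.mem_filter.mp hj).1).wordWeight_eq p q ht hw').symm
  rw [Finset.sum_congr rfl fun w' hw' => hbr w' (Finset.mem_filter.mp hw').2,
    Finset.sum_sigma']
  symm
  refine Finset.sum_bij (fun a _ => Function.update a.1 a.2 ((a.1 a.2).1, x)) ?_ ?_ ?_ ?_
  · rintro ⟨w', j⟩ ha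
    simp only [Finset.mem_sigma, Finset.mem_filter, Finset.mem_univ, true_and] at ha
    exact Finset.mem_filter.mpr ⟨Finset.mem_univ _,
      (fillValley_update ha.2.1).isZig ht ha.1 ha.2.2, j, by simp⟩
  · rintro ⟨w₁, j₁⟩ h₁ ⟨w₂, j₂⟩ h₂ h
    simp only [Finset.mem_sigma, Finset.mem_filter, Finset.mem_univ, true_and] at h₁ h₂ h
    have H₁ := fillValley_update (x := x) h₁.2.1
    have H₂ := fillValley_update (x := x) h₂.2.1
    rw [← h] at H₂
    obtain ⟨rfl, rfl⟩ := H₁.unique H₂ ht (H₁.isZig ht h₁.1 h₁.2.2)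
    rfl
  · intro w hw
    obtain ⟨-, hw, j, hj⟩ := Finset.mem_filter.mp hw
    have H : FillValley x j w (Function.update w j ((w j).1, 0)) := by
      refine ⟨fun i => ?_, fun i hi => by simp [hi], hj, by simp⟩
      by_cases hi : i = j
      · subst hi
        simp
      · simp [hi]
    have hz := H.isZig_old ht hw
    refine ⟨⟨Function.update w j ((w j).1, 0), j⟩, ?_, ?_⟩
    · simp only [Finset.mem_sigma, Finset.mem_filter, Finset.mem_univ, true_and]
      exact ⟨hz.1, mem_zeros.mpr H.old, hz.2⟩
    · simp [← hj]
  · exact fun _ _ => rfl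

open Classical in
-- If `x` is no valley it is a peak, and deleting its pair is inverse to inserting `(x, 0)` into an
-- admissible gap.
lemma sum_peak (d t : ℕ) (ht : 1 ≤ t) (x : Fin (n + 1)) (hx : x.val = t) :
    ∑ w : Fin (m + 1) → Fin (n + 1) × Fin (n + 1) with IsZig d t w ∧ ¬ ∃ j, (w j).2 = x,
        wordWeight p q d w =
      ∑ w' : Fin m → Fin (n + 1) × Fin (n + 1) with IsZig d (t + 1) w',
        br p q (#(zeros w') + 1) * wordWeight p q d w' := by
  subst hx
  have hbr : ∀ w' : Fin m → Fin (n + 1) × Fin (n + 1), IsZig d (x.val + 1) w' →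
      br p q (#(zeros w') + 1) * wordWeight p q d w' =
        ∑ g : Fin (m + 1) with ∀ k : Fin m, k.val + 1 = g.val → k ∈ zeros w',
          wordWeight p q d
            (g.insertNth (α := fun _ => Fin (n + 1) × Fin (n + 1)) (x, 0) w') := by
    intro w' hw'
    rw [← sum_gap, Finset.sum_mul]
    refine Finset.sum_congr (Finset.filter_congr fun _ _ => Iff.rfl) fun g _ => ?_
    exact ((insertPeak_insertNth x g w').wordWeight_eq p q ht hw').symm
  rw [Finset.sum_congr rfl fun w' hw' => hbr w' (Finset.mem_filter.mp hw').2,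
    Finset.sum_sigma']
  symm
  refine Finset.sum_bij
    (fun a _ => a.2.insertNth (α := fun _ => Fin (n + 1) × Fin (n + 1)) (x, 0) a.1) ?_ ?_ ?_ ?_
  · rintro ⟨w', g⟩ ha
    simp only [Finset.mem_sigma, Finset.mem_filter, Finset.mem_univ, true_and] at ha
    have H := insertPeak_insertNth x g w'
    have hz := H.isZig ht ha.1 ha.2
    refine Finset.mem_filter.mpr ⟨Finset.mem_univ _, hz, ?_⟩
    rintro ⟨j, hj⟩
    exact hz.peak_ne g j (by rw [hj, H.new])
  · rintro ⟨w₁, g₁⟩ h₁ ⟨w₂, g₂⟩ h₂ h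
    simp only [Finset.mem_sigma, Finset.mem_filter, Finset.mem_univ, true_and] at h₁ h₂ h
    have H₁ := insertPeak_insertNth x g₁ w₁
    have H₂ := insertPeak_insertNth x g₂ w₂
    rw [← h] at H₂
    obtain ⟨rfl, rfl⟩ := H₁.unique H₂ (H₁.isZig ht h₁.1 h₁.2)
    rfl
  · intro w hw
    obtain ⟨-, hw, hn⟩ := Finset.mem_filter.mp hw
    obtain ⟨g, hg⟩ := hw.exists_eq x le_rfl
    have hg := hg.resolve_right fun h => hn ⟨g, h⟩
    -- No remaining value lies below `x`, so the valley of this pair is already erased.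
    have hg0 : (w g).2 = 0 := by
      have h1 := hw.valley g
      have h2 := hw.desc g
      rw [hg, Fin.lt_def] at h2
      exact Fin.ext (by simp only [Fin.val_zero]; omega)
    have H : InsertPeak x g w (fun k => w (g.succAbove k)) :=
      ⟨Prod.ext hg hg0, fun _ => rfl⟩
    have hz := H.isZig_old ht hw
    refine ⟨⟨fun k => w (g.succAbove k), g⟩, ?_, ?_⟩
    · simp only [Finset.mem_sigma, Finset.mem_filter, Finset.mem_univ, true_and]
      exact hz
    · rw [← H.new]
      exact Fin.insertNth_self_removeNth g w
  · exact fun _ _ => rfl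

open Classical in
lemma sum_br_mul (d t c : ℕ) (f : ℕ → ℕ)
    (h : ∀ w : Fin m → Fin (n + 1) × Fin (n + 1), IsZig d t w → f #(zeros w) = c) :
    ∑ w : Fin m → Fin (n + 1) × Fin (n + 1) with IsZig d t w,
        br p q (f #(zeros w)) * wordWeight p q d w = br p q c * wordSum p q n m d t := by
  rw [wordSum, Finset.mul_sum]
  exact Finset.sum_congr rfl fun w hw => by rw [h w (Finset.mem_filter.mp hw).2]

/-- Here `r` is the number of remaining values and, by `card_zeros`, `h` the number of zeros.
Erasing a valley raises `h` by one; erasing a peak lowers both `h` and `m` by one. -/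
lemma wordSum_eq_zigSum (d : ℕ) (hd : d ≤ 1) (r t h m : ℕ) (ht : 1 ≤ t) (hr : t + r = n + 1)
    (hm : h + r = 2 * m) : wordSum p q n m d t = zigSum p q d r h := by
  classical
  induction r generalizing t h m with
  | zero =>
    rw [zigSum, wordSum]
    split_ifs with h0
    · obtain rfl : m = 0 := by omega
      have hz : ∀ w : Fin 0 → Fin (n + 1) × Fin (n + 1), IsZig d t w := fun w =>
        ⟨fun v hv => absurd v.isLt (by omega), fun i => i.elim0, fun i => i.elim0,
          fun i => i.elim0, fun i => i.elim0, fun i => i.elim0, fun i => i.elim0,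
          fun i => i.elim0, fun _ i => i.elim0⟩
      simp [hz, wordWeight]
    · refine Finset.sum_eq_zero fun w hw => ?_
      have h1 := (Finset.mem_filter.mp hw).2.le_peak ⟨0, by omega⟩
      have h2 := (w ⟨0, by omega⟩).1.isLt
      omega
  | succ r ih =>
    obtain ⟨m, rfl⟩ : ∃ k, m = k + 1 := ⟨m - 1, by omega⟩
    have hx : ((⟨t, by omega⟩ : Fin (n + 1)) : ℕ) = t := rfl
    rw [wordSum, ← Finset.sum_filter_add_sum_filter_not _
      (fun w : Fin (m + 1) → Fin (n + 1) × Fin (n + 1) => ∃ j, (w j).2 = ⟨t, by omega⟩),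
      Finset.filter_filter, Finset.filter_filter, sum_valley p q d t hd ht _ hx,
      sum_peak p q d t ht _ hx, zigSum]
    congr 1
    · rw [sum_br_mul p q d (t + 1) (h + 1 - d) (fun k => k - d), ih (t + 1) (h + 1) (m + 1)]
      · omega
      · omega
      · omega
      · intro w hw
        have := card_zeros (by omega) hw
        omega
    · rw [sum_br_mul p q d (t + 1) h (fun k => k + 1)]
      -- At `h = 0` the factor `br p q 0` kills the term; the induction hypothesis would not apply
      -- there.
      · rcases h with _ | h
        · simp
        · rw [Nat.add_sub_cancel, ih (t + 1) h m]
          · omega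
          · omega
          · omega
      · intro w hw
        have := card_zeros (by omega) hw
        omega

end WordSums

end PermStat

namespace PermStat

open Finset

/-! ### Alternating permutations as complete words. -/

section Patterns

variable {n : ℕ}

/-- The values of a permutation as positive integers, extended by `0`. -/
def ext (σ : Equiv.Perm (Fin n)) (x : ℕ) : ℕ := if h : x < n then (σ ⟨x, h⟩).val + 1 else 0

lemma ext_coe (σ : Equiv.Perm (Fin n)) (x : Fin n) : ext σ x.val = (σ x).val + 1 := by
  simp [ext]

lemma ext_of_le (σ : Equiv.Perm (Fin n)) {x : ℕ} (h : n ≤ x) : ext σ x = 0 := by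
  simp [ext, not_lt.mpr h]

lemma ext_pos (σ : Equiv.Perm (Fin n)) {x : ℕ} (h : x < n) : 0 < ext σ x := by
  simp [ext, h]

lemma ext_le (σ : Equiv.Perm (Fin n)) (x : ℕ) : ext σ x < n + 1 := by
  rw [ext]
  split_ifs
  · omega
  · omega

lemma ext_inj (σ : Equiv.Perm (Fin n)) {x y : ℕ} (hx : x < n) (h : ext σ x = ext σ y) :
    x = y := by
  have hy : y < n := by
    by_contra hy
    have := ext_pos σ hx
    rw [h, ext_of_le σ (not_lt.mp hy)] at this
    exact lt_irrefl _ this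
  rw [ext, ext, dif_pos hx, dif_pos hy, Nat.add_right_cancel_iff, ← Fin.ext_iff] at h
  exact Fin.mk.inj (σ.injective h)

lemma exists_ext_eq (σ : Equiv.Perm (Fin n)) {v : ℕ} (h1 : 1 ≤ v) (h2 : v ≤ n) :
    ∃ x < n, ext σ x = v := by
  refine ⟨(σ.symm ⟨v - 1, by omega⟩).val, (σ.symm ⟨v - 1, by omega⟩).isLt, ?_⟩
  rw [ext_coe, Equiv.apply_symm_apply]
  simp only
  omega

lemma sum_eq_val {k : ℕ} (Q : Prop) [Decidable Q] :
    ∑ b : Fin n, (if k = b.val ∧ Q then 1 else 0) = if k < n ∧ Q then 1 else 0 := by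
  rw [Fin.sum_univ_eq_sum_range (fun b => if k = b ∧ Q then 1 else 0)]
  by_cases hQ : Q
  · simp [hQ]
  · simp [hQ]

/-- Used with `N = 2 * m`, so that for odd `n` positions still split into pairs, the padding
position contributing nothing. -/
lemma sum_range_pad {N : ℕ} (h1 : n ≤ N) (h2 : N ≤ n + 1) (G : ℕ → ℕ) (hG : G n = 0) :
    ∑ x ∈ range n, G x = ∑ x ∈ range N, G x := by
  obtain rfl | rfl : N = n ∨ N = n + 1 := by omega
  · rfl
  · rw [Finset.sum_range_succ, hG, add_zero]

lemma sum_range_two_mul (G : ℕ → ℕ) (m : ℕ) :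
    ∑ x ∈ range (2 * m), G x = ∑ i ∈ range m, (G (2 * i) + G (2 * i + 1)) := by
  induction m with
  | zero => simp
  | succ m ih =>
    rw [show 2 * (m + 1) = 2 * m + 1 + 1 by ring, Finset.sum_range_succ, Finset.sum_range_succ, ih,
      Finset.sum_range_succ]
    ring

lemma pat31_2_eq (σ : Equiv.Perm (Fin n)) : pat31_2 σ = ∑ c ∈ range n, ∑ a ∈ range n,
    if a + 1 < n ∧ a + 1 < c ∧ ext σ (a + 1) < ext σ c ∧ ext σ c < ext σ a then 1 else 0 := by
  rw [pat31_2, Finset.card_filter, Fintype.sum_prod_type, Finset.sum_comm (s := range n),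
    ← Fin.sum_univ_eq_sum_range (fun a => ∑ c ∈ range n,
      if a + 1 < n ∧ a + 1 < c ∧ ext σ (a + 1) < ext σ c ∧ ext σ c < ext σ a then 1 else 0)]
  refine Finset.sum_congr rfl fun a _ => ?_
  rw [Fintype.sum_prod_type, Finset.sum_comm, ← Fin.sum_univ_eq_sum_range (fun c =>
      if a.val + 1 < n ∧ a.val + 1 < c ∧ ext σ (a + 1) < ext σ c ∧ ext σ c < ext σ a
        then 1 else 0)]
  refine Finset.sum_congr rfl fun c _ => ?_
  rw [← sum_eq_val]
  refine Finset.sum_congr rfl fun b _ => if_congr ?_ rfl rfl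
  refine and_congr_right fun hb => ?_
  dsimp only at hb ⊢
  rw [hb, ext_coe, ext_coe, ext_coe, Fin.lt_def, Fin.lt_def, Fin.lt_def]
  omega

lemma pat2_31_eq (σ : Equiv.Perm (Fin n)) : pat2_31 σ = ∑ a ∈ range n, ∑ b ∈ range n,
    if b + 1 < n ∧ a < b ∧ ext σ (b + 1) < ext σ a ∧ ext σ a < ext σ b then 1 else 0 := by
  rw [pat2_31, Finset.card_filter, Fintype.sum_prod_type,
    ← Fin.sum_univ_eq_sum_range (fun a => ∑ b ∈ range n,
      if b + 1 < n ∧ a < b ∧ ext σ (b + 1) < ext σ a ∧ ext σ a < ext σ b then 1 else 0)]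
  refine Finset.sum_congr rfl fun a _ => ?_
  rw [Fintype.sum_prod_type, ← Fin.sum_univ_eq_sum_range (fun b =>
      if b + 1 < n ∧ a.val < b ∧ ext σ (b + 1) < ext σ a ∧ ext σ a < ext σ b then 1 else 0)]
  refine Finset.sum_congr rfl fun b _ => ?_
  rw [← sum_eq_val]
  refine Finset.sum_congr rfl fun c _ => if_congr ?_ rfl rfl
  rw [and_left_comm]
  refine and_congr_right fun hb => ?_
  dsimp only at hb ⊢
  rw [hb, ext_coe, ext_coe, ext_coe, Fin.lt_def, Fin.lt_def, Fin.lt_def]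
  omega

lemma pat2_13_eq (σ : Equiv.Perm (Fin n)) : pat2_13 σ = ∑ a ∈ range n, ∑ b ∈ range n,
    if b + 1 < n ∧ a < b ∧ ext σ b < ext σ a ∧ ext σ a < ext σ (b + 1) then 1 else 0 := by
  rw [pat2_13, Finset.card_filter, Fintype.sum_prod_type,
    ← Fin.sum_univ_eq_sum_range (fun a => ∑ b ∈ range n,
      if b + 1 < n ∧ a < b ∧ ext σ b < ext σ a ∧ ext σ a < ext σ (b + 1) then 1 else 0)]
  refine Finset.sum_congr rfl fun a _ => ?_
  rw [Fintype.sum_prod_type, ← Fin.sum_univ_eq_sum_range (fun b =>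
      if b + 1 < n ∧ a.val < b ∧ ext σ b < ext σ a ∧ ext σ a < ext σ (b + 1) then 1 else 0)]
  refine Finset.sum_congr rfl fun b _ => ?_
  rw [← sum_eq_val]
  refine Finset.sum_congr rfl fun c _ => if_congr ?_ rfl rfl
  rw [and_left_comm]
  refine and_congr_right fun hb => ?_
  dsimp only at hb ⊢
  rw [hb, ext_coe, ext_coe, ext_coe, Fin.lt_def, Fin.lt_def, Fin.lt_def]
  omega

/-- The word of pairs of consecutive values of a permutation. -/
def toWord (m : ℕ) (σ : Equiv.Perm (Fin n)) (i : Fin m) : Fin (n + 1) × Fin (n + 1) :=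
  (⟨ext σ (2 * i), ext_le _ _⟩, ⟨ext σ (2 * i + 1), ext_le _ _⟩)

lemma lft_toWord (m : ℕ) (σ : Equiv.Perm (Fin n)) (i : Fin m) (x : Fin (n + 1)) :
    lft (toWord m σ) i x = ∑ j ∈ range m,
      if j < i.val ∧ ext σ (2 * j + 1) < x.val ∧ x.val < ext σ (2 * j) then 1 else 0 := by
  rw [lft, Finset.card_filter, ← Fin.sum_univ_eq_sum_range (fun j =>
    if j < i.val ∧ ext σ (2 * j + 1) < x.val ∧ x.val < ext σ (2 * j) then 1 else 0)]
  rfl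

lemma rgt_toWord (m : ℕ) (σ : Equiv.Perm (Fin n)) (i : Fin m) (x : Fin (n + 1)) :
    rgt (toWord m σ) i x = ∑ j ∈ range m,
      if i.val < j ∧ ext σ (2 * j + 1) < x.val ∧ x.val < ext σ (2 * j) then 1 else 0 := by
  rw [rgt, Finset.card_filter, ← Fin.sum_univ_eq_sum_range (fun j =>
    if i.val < j ∧ ext σ (2 * j + 1) < x.val ∧ x.val < ext σ (2 * j) then 1 else 0)]
  rfl

/-- The word of a permutation is alternating. -/
structure ExtAlt (m : ℕ) (s : ℕ → ℕ) : Prop where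
  desc : ∀ i < m, s (2 * i + 1) < s (2 * i)
  asc : ∀ i, i + 1 < m → s (2 * i + 1) < s (2 * i + 2)

lemma mem_alternating_iff {m d : ℕ} (hd : d ≤ 1) (hm : 2 * m = n + d)
    (σ : Equiv.Perm (Fin n)) : σ ∈ alternating n ↔ ExtAlt m (ext σ) := by
  rw [alternating, Finset.mem_filter]
  simp only [Finset.mem_univ, true_and]
  constructor
  · refine fun H => ⟨fun i hi => ?_, fun i hi => ?_⟩
    · by_cases h : 2 * i + 1 < n
      · have := (H ⟨2 * i, by omega⟩ ⟨2 * i + 1, h⟩ rfl).1 (by simp)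
        rw [Fin.lt_def] at this
        rw [ext, ext, dif_pos h, dif_pos (by omega)]
        omega
      · rw [ext_of_le σ (not_lt.mp h)]
        exact ext_pos σ (by omega)
    · have := (H ⟨2 * i + 1, by omega⟩ ⟨2 * i + 2, by omega⟩ rfl).2 (by simp only; omega)
      rw [Fin.lt_def] at this
      rw [ext, ext, dif_pos (by omega), dif_pos (by omega)]
      omega
  · refine fun H i j hij => ⟨fun hi => ?_, fun hi => ?_⟩
    · have := H.desc (i.val / 2) (by omega)
      rw [show 2 * (i.val / 2) + 1 = j.val by omega, show 2 * (i.val / 2) = i.val by omega,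
        ext_coe, ext_coe] at this
      rw [Fin.lt_def]
      omega
    · have := H.asc (i.val / 2) (by omega)
      rw [show 2 * (i.val / 2) + 1 = i.val by omega,
        show 2 * (i.val / 2) + 2 = j.val by omega, ext_coe, ext_coe] at this
      rw [Fin.lt_def]
      omega

lemma isZig_toWord {m d : ℕ} (hd : d ≤ 1) (hm : 2 * m = n + d) {σ : Equiv.Perm (Fin n)}
    (H : ExtAlt m (ext σ)) : IsZig d 1 (toWord m σ) where
  exists_eq v hv := by
    obtain ⟨x, hx, hxv⟩ := exists_ext_eq σ hv (Nat.lt_succ_iff.mp v.isLt)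
    refine ⟨⟨x / 2, by omega⟩, ?_⟩
    rcases Nat.mod_two_eq_zero_or_one x with h | h
    · left
      simp only [toWord, Fin.ext_iff]
      rw [show 2 * (x / 2) = x by omega, hxv]
    · right
      simp only [toWord, Fin.ext_iff]
      rw [show 2 * (x / 2) + 1 = x by omega, hxv]
  le_peak i := ext_pos σ (by omega)
  valley i := Nat.eq_zero_or_pos _
  peak_inj i j h := by
    have := ext_inj σ (by omega) (Fin.ext_iff.mp h)
    exact Fin.ext (by omega)
  valley_inj i j h h0 := by
    have hi : 2 * i.val + 1 < n := by
      by_contra hi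
      exact h0 (ext_of_le σ (not_lt.mp hi))
    have := ext_inj σ hi (Fin.ext_iff.mp h)
    exact Fin.ext (by omega)
  peak_ne i j h := by
    have := ext_inj σ (by omega) (Fin.ext_iff.mp h)
    omega
  desc i := H.desc i i.isLt
  asc i j hij := by
    have := H.asc i.val (by omega)
    rw [show 2 * i.val + 2 = 2 * j.val by omega] at this
    exact this
  last hd1 i hi := ext_of_le σ (by omega)

lemma toWord_injective {m d : ℕ} (hm : 2 * m = n + d) :
    Function.Injective (toWord (n := n) m) := by
  intro σ σ' h
  ext x
  have h1 := congrFun h ⟨x.val / 2, by omega⟩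
  simp only [toWord, Prod.mk.injEq, Fin.mk.injEq] at h1
  rcases Nat.mod_two_eq_zero_or_one x.val with h2 | h2
  · have h3 := h1.1
    rw [show 2 * (x.val / 2) = x.val by omega, ext_coe, ext_coe] at h3
    omega
  · have h3 := h1.2
    rw [show 2 * (x.val / 2) + 1 = x.val by omega, ext_coe, ext_coe] at h3
    omega

/-- At `t = 1` there are exactly `d` zeros by `card_zeros`; for `d = 1` the only one is the final
valley. -/
lemma IsZig.valley_ne_zero {m d : ℕ} (hd : d ≤ 1) (hm : 2 * m = n + d)
    {w : Fin m → Fin (n + 1) × Fin (n + 1)} (hw : IsZig d 1 w) (i : Fin m)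
    (hi : 2 * i.val + 1 < n) : (w i).2.val ≠ 0 := by
  intro h0
  have hc := card_zeros le_rfl hw
  have hiz : i ∈ zeros w := mem_zeros.mpr h0
  have hpos := Finset.card_pos.mpr ⟨i, hiz⟩
  have hd1 : d = 1 := by omega
  have hl : (⟨m - 1, by omega⟩ : Fin m) ∈ zeros w :=
    mem_zeros.mpr (hw.last hd1 _ (by simp only; omega))
  have h1 := Finset.card_le_one.mp (by omega : #(zeros w) ≤ 1) _ hiz _ hl
  rw [Fin.ext_iff] at h1
  simp only at h1
  omega

lemma exists_toWord_eq {m d : ℕ} (hd : d ≤ 1) (hm : 2 * m = n + d)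
    {w : Fin m → Fin (n + 1) × Fin (n + 1)} (hw : IsZig d 1 w) :
    ∃ σ : Equiv.Perm (Fin n), toWord m σ = w := by
  let f : Fin n → Fin (n + 1) := fun x =>
    if x.val % 2 = 0 then (w ⟨x.val / 2, by omega⟩).1 else (w ⟨x.val / 2, by omega⟩).2
  have hf0 : ∀ x, f x ≠ 0 := by
    intro x h
    by_cases hx : x.val % 2 = 0
    · have := hw.le_peak ⟨x.val / 2, by omega⟩
      simp only [f, if_pos hx] at h
      rw [h] at this
      simp at this
    · have := hw.valley_ne_zero hd hm ⟨x.val / 2, by omega⟩ (by simp only; omega)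
      simp only [f, if_neg hx] at h
      rw [h] at this
      simp at this
  have hfinj : Function.Injective f := by
    intro x y h
    by_cases hx : x.val % 2 = 0 <;> by_cases hy : y.val % 2 = 0
    · simp only [f, if_pos hx, if_pos hy] at h
      have := Fin.mk.inj (hw.peak_inj _ _ h)
      exact Fin.ext (by omega)
    · simp only [f, if_pos hx, if_neg hy] at h
      exact absurd h (hw.peak_ne _ _)
    · simp only [f, if_neg hx, if_pos hy] at h
      exact absurd h.symm (hw.peak_ne _ _)
    · have h0 := hf0 x
      simp only [f, if_neg hx, if_neg hy] at h h0
      have := Fin.mk.inj (hw.valley_inj _ _ h (fun h1 => h0 (Fin.ext h1)))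
      exact Fin.ext (by omega)
  -- The letters are distinct and nonzero, so lowering them by one gives an injective self-map of
  -- `Fin n`.
  have hgb : Function.Bijective fun x => (f x).pred (hf0 x) :=
    Finite.injective_iff_bijective.mp fun x y h => hfinj (Fin.pred_inj.mp h)
  refine ⟨Equiv.ofBijective _ hgb, ?_⟩
  have hext : ∀ x : Fin n, ext (Equiv.ofBijective _ hgb) x.val = (f x).val := by
    intro x
    have := Fin.pos_iff_ne_zero.mpr (hf0 x)
    rw [Fin.lt_def, Fin.val_zero] at this
    rw [ext_coe, Equiv.ofBijective_apply, Fin.val_pred]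
    omega
  funext i
  refine Prod.ext (Fin.ext ?_) (Fin.ext ?_)
  · have := hext ⟨2 * i.val, by omega⟩
    simp only [toWord]
    rw [this]
    simp [f]
  · by_cases hi : 2 * i.val + 1 < n
    · have := hext ⟨2 * i.val + 1, hi⟩
      simp only [toWord]
      rw [this]
      have h2 : (2 * i.val + 1) / 2 = i.val := by omega
      simp [f, h2]
    · simp only [toWord]
      rw [ext_of_le _ (not_lt.mp hi), hw.last (by omega) i (by omega)]

end Patterns

/-! ### Pattern counts as straddling counts. -/

section Transfer

variable {R : Type*} [CommRing R] (p q : R) {n : ℕ}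

lemma lft_of_val_eq_zero {m : ℕ} (w : Fin m → Fin (n + 1) × Fin (n + 1)) (i : Fin m)
    {x : Fin (n + 1)} (hx : x.val = 0) : lft w i x = 0 := by
  rw [lft, Finset.card_eq_zero, Finset.filter_eq_empty_iff]
  rintro j - ⟨-, h, -⟩
  rw [Fin.lt_def] at h
  omega

lemma rgt_of_val_eq_zero {m : ℕ} (w : Fin m → Fin (n + 1) × Fin (n + 1)) (i : Fin m)
    {x : Fin (n + 1)} (hx : x.val = 0) : rgt w i x = 0 := by
  rw [rgt, Finset.card_eq_zero, Finset.filter_eq_empty_iff]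
  rintro j - ⟨-, h, -⟩
  rw [Fin.lt_def] at h
  omega

/-- Nothing straddles the value `0`, so zero valleys need no separate treatment in the exponents. -/
lemma wordWeight_eq_pow {m : ℕ} (d : ℕ) (w : Fin m → Fin (n + 1) × Fin (n + 1)) :
    wordWeight p q d w = p ^ (∑ i, (rgt w i (w i).1 + (rgt w i (w i).2 - d))) *
      q ^ (∑ i, (lft w i (w i).1 + lft w i (w i).2)) := by
  rw [wordWeight, ← Finset.prod_pow_eq_pow_sum, ← Finset.prod_pow_eq_pow_sum,
    ← Finset.prod_mul_distrib]
  refine Finset.prod_congr rfl fun i _ => ?_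
  split_ifs with h
  · rw [lft_of_val_eq_zero w i h, rgt_of_val_eq_zero w i h]
    simp
    ring
  · ring

lemma pat31_2_eq_lft {m d : ℕ} (hd : d ≤ 1) (hm : 2 * m = n + d) {σ : Equiv.Perm (Fin n)}
    (H : ExtAlt m (ext σ)) :
    pat31_2 σ = ∑ i, (lft (toWord m σ) i (toWord m σ i).1 +
      lft (toWord m σ) i (toWord m σ i).2) := by
  have inner : ∀ c i, i < m → c = 2 * i ∨ c = 2 * i + 1 → ∑ a ∈ range n,
      (if a + 1 < n ∧ a + 1 < c ∧ ext σ (a + 1) < ext σ c ∧ ext σ c < ext σ a then 1 else 0) =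
      ∑ j ∈ range m,
        if j < i ∧ ext σ (2 * j + 1) < ext σ c ∧ ext σ c < ext σ (2 * j) then 1 else 0 := by
    intro c i hi hc
    rw [sum_range_pad (by omega) (by omega : 2 * m ≤ n + 1) _ (if_neg (by omega)),
      sum_range_two_mul]
    refine Finset.sum_congr rfl fun j hj => ?_
    rw [Finset.mem_range] at hj
    have h1 : j + 1 < m → ext σ (2 * j + 1) < ext σ (2 * j + 1 + 1) := H.asc j
    -- Odd positions start ascents, which cannot play the role of the descent 31.
    rw [if_neg (c := 2 * j + 1 + 1 < n ∧ _) (by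
      rintro ⟨h2, h3, h4, h5⟩
      have := h1 (by omega)
      omega), add_zero]
    exact if_congr (by omega) rfl rfl
  rw [pat31_2_eq, sum_range_pad (by omega) (by omega : 2 * m ≤ n + 1), sum_range_two_mul,
    ← Fin.sum_univ_eq_sum_range (fun i => ∑ a ∈ range n, (if a + 1 < n ∧ a + 1 < 2 * i ∧
        ext σ (a + 1) < ext σ (2 * i) ∧ ext σ (2 * i) < ext σ a then 1 else 0) +
      ∑ a ∈ range n, (if a + 1 < n ∧ a + 1 < 2 * i + 1 ∧ ext σ (a + 1) < ext σ (2 * i + 1) ∧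
        ext σ (2 * i + 1) < ext σ a then 1 else 0))]
  · refine Finset.sum_congr rfl fun i _ => ?_
    rw [lft_toWord, lft_toWord, inner _ i i.isLt (Or.inl rfl), inner _ i i.isLt (Or.inr rfl)]
    rfl
  · refine Finset.sum_eq_zero fun a _ => if_neg ?_
    rw [ext_of_le σ le_rfl]
    omega

lemma pat2_31_eq_rgt {m : ℕ} (hm : 2 * m = n) {σ : Equiv.Perm (Fin n)}
    (H : ExtAlt m (ext σ)) :
    pat2_31 σ = ∑ i, (rgt (toWord m σ) i (toWord m σ i).1 +
      (rgt (toWord m σ) i (toWord m σ i).2 - 0)) := by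
  have inner : ∀ a i, i < m → a = 2 * i ∨ a = 2 * i + 1 → ∑ b ∈ range n,
      (if b + 1 < n ∧ a < b ∧ ext σ (b + 1) < ext σ a ∧ ext σ a < ext σ b then 1 else 0) =
      ∑ j ∈ range m,
        if i < j ∧ ext σ (2 * j + 1) < ext σ a ∧ ext σ a < ext σ (2 * j) then 1 else 0 := by
    intro a i hi ha
    rw [sum_range_pad (n := n) (by omega) (by omega : 2 * m ≤ n + 1) _ (if_neg (by omega)),
      sum_range_two_mul]
    refine Finset.sum_congr rfl fun j hj => ?_
    rw [Finset.mem_range] at hj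
    have h1 : j + 1 < m → ext σ (2 * j + 1) < ext σ (2 * j + 1 + 1) := H.asc j
    rw [if_neg (c := 2 * j + 1 + 1 < n ∧ _) (by
      rintro ⟨h2, h3, h4, h5⟩
      have := h1 (by omega)
      omega), add_zero]
    exact if_congr (by omega) rfl rfl
  rw [pat2_31_eq, sum_range_pad (n := n) (by omega) (by omega : 2 * m ≤ n + 1), sum_range_two_mul,
    ← Fin.sum_univ_eq_sum_range (fun i => ∑ b ∈ range n, (if b + 1 < n ∧ 2 * i < b ∧
        ext σ (b + 1) < ext σ (2 * i) ∧ ext σ (2 * i) < ext σ b then 1 else 0) +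
      ∑ b ∈ range n, (if b + 1 < n ∧ 2 * i + 1 < b ∧ ext σ (b + 1) < ext σ (2 * i + 1) ∧
        ext σ (2 * i + 1) < ext σ b then 1 else 0))]
  · refine Finset.sum_congr rfl fun i _ => ?_
    rw [rgt_toWord, rgt_toWord, inner _ i i.isLt (Or.inl rfl), inner _ i i.isLt (Or.inr rfl)]
    rfl
  · refine Finset.sum_eq_zero fun b _ => if_neg ?_
    rw [ext_of_le σ le_rfl]
    omega

/-- Along an alternating sequence, the ascents and the descents which straddle a given value
alternate. -/
lemma straddle_telescope (P V : ℕ → ℕ) (x i k : ℕ)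
    (hdesc : ∀ j, i < j → j ≤ i + k → V j < P j)
    (hasc : ∀ j, i ≤ j → j < i + k → V j < P (j + 1))
    (hne : ∀ j, i < j → j ≤ i + k → P j ≠ x) :
    (∑ j ∈ Ico i (i + k), if V j < x ∧ x < P (j + 1) then 1 else 0) +
        (if V (i + k) < x then 1 else 0) =
      (∑ j ∈ Ico (i + 1) (i + k + 1), if V j < x ∧ x < P j then 1 else 0) +
        (if V i < x then 1 else 0) := by
  induction k with
  | zero => simp
  | succ k ih =>
    have ih := ih (fun j h1 h2 => hdesc j h1 (by omega)) (fun j h1 h2 => hasc j h1 (by omega))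
      (fun j h1 h2 => hne j h1 (by omega))
    have h1 := hdesc (i + k + 1) (by omega) (by omega)
    have h2 := hasc (i + k) (by omega) (by omega)
    have h3 := hne (i + k + 1) (by omega) (by omega)
    -- The peak exceeds both neighbouring valleys: if it is below `x` so are they, and if it is
    -- above `x` the straddling conditions reduce to `V < x`.
    have key : (if V (i + k) < x ∧ x < P (i + k + 1) then 1 else 0) +
        (if V (i + k + 1) < x then 1 else 0) =
        (if V (i + k + 1) < x ∧ x < P (i + k + 1) then 1 else 0) +
        (if V (i + k) < x then 1 else 0) := by
      split_ifs <;> omega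
    rw [← Nat.add_assoc, Finset.sum_Ico_succ_top (by omega),
      Finset.sum_Ico_succ_top (b := i + k + 1) (by omega)]
    omega

/-- The final valley `0` lies below every value, so `straddle_telescope` gives ascents + 1 =
descents + [own valley below the value]. The bracket is one for a peak and zero for a valley; this
is the `- 1` on valleys. -/
lemma pat2_13_eq_rgt {m : ℕ} (hm : 2 * m = n + 1) {σ : Equiv.Perm (Fin n)}
    (H : ExtAlt m (ext σ)) :
    pat2_13 σ = ∑ i, (rgt (toWord m σ) i (toWord m σ i).1 +
      (rgt (toWord m σ) i (toWord m σ i).2 - 1)) := by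
  have inner : ∀ a i, i < m → a = 2 * i ∨ a = 2 * i + 1 → ∑ b ∈ range n,
      (if b + 1 < n ∧ a < b ∧ ext σ b < ext σ a ∧ ext σ a < ext σ (b + 1) then 1 else 0) =
      ∑ j ∈ Ico i (m - 1),
        if ext σ (2 * j + 1) < ext σ a ∧ ext σ a < ext σ (2 * (j + 1)) then 1 else 0 := by
    intro a i hi ha
    rw [sum_range_pad (n := n) (by omega) (by omega : 2 * m ≤ n + 1) _ (if_neg (by omega)),
      sum_range_two_mul]
    have hI : Ico i (m - 1) = (range m).filter fun j => i ≤ j ∧ j + 1 < m := by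
      ext j
      simp only [Finset.mem_Ico, Finset.mem_filter, Finset.mem_range]
      omega
    rw [hI, Finset.sum_filter]
    refine Finset.sum_congr rfl fun j hj => ?_
    rw [Finset.mem_range] at hj
    have h1 := H.desc j hj
    rw [if_neg (c := 2 * j + 1 < n ∧ _) (by omega), zero_add, ← ite_and]
    refine if_congr ?_ rfl rfl
    rw [show 2 * j + 1 + 1 = 2 * (j + 1) by ring]
    constructor
    · rintro ⟨h2, h3, h4, h5⟩
      exact ⟨by omega, h4, h5⟩
    · rintro ⟨h2, h4, h5⟩
      -- The interval starts at `i` in both cases: the ascent after a peak `a = 2 * i` lies to its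
      -- right, whereas for a valley `a = 2 * i + 1` the term `j = i` fails by strictness.
      have h6 : a ≠ 2 * j + 1 := by
        rintro rfl
        exact lt_irrefl _ h4
      exact ⟨by omega, by omega, h4, h5⟩
  have hr : ∀ x i, ∑ j ∈ range m,
      (if i < j ∧ ext σ (2 * j + 1) < x ∧ x < ext σ (2 * j) then 1 else 0) =
      ∑ j ∈ Ico (i + 1) m, if ext σ (2 * j + 1) < x ∧ x < ext σ (2 * j) then 1 else 0 := by
    intro x i
    have hI : Ico (i + 1) m = (range m).filter fun j => i < j := by
      ext j
      simp only [Finset.mem_Ico, Finset.mem_filter, Finset.mem_range]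
      omega
    rw [hI, Finset.sum_filter]
    exact Finset.sum_congr rfl fun j _ => ite_and _ _ _ _
  have tele : ∀ a i, i < m → a = 2 * i ∨ a = 2 * i + 1 → a < n →
      (∑ j ∈ Ico i (m - 1),
        if ext σ (2 * j + 1) < ext σ a ∧ ext σ a < ext σ (2 * (j + 1)) then 1 else 0) + 1 =
      (∑ j ∈ Ico (i + 1) m, if ext σ (2 * j + 1) < ext σ a ∧ ext σ a < ext σ (2 * j)
        then 1 else 0) + if ext σ (2 * i + 1) < ext σ a then 1 else 0 := by
    intro a i hi ha han
    have := straddle_telescope (fun j => ext σ (2 * j)) (fun j => ext σ (2 * j + 1)) (ext σ a) i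
      (m - 1 - i) (fun j _ h2 => H.desc j (by omega)) (fun j _ h2 => H.asc j (by omega))
      (fun j h1 h2 h3 => by
        have := ext_inj σ han h3.symm
        omega)
    rw [show i + (m - 1 - i) = m - 1 by omega, show m - 1 + 1 = m by omega,
      if_pos (c := ext σ (2 * (m - 1) + 1) < ext σ a)
        (by rw [ext_of_le σ (by omega)]; exact ext_pos σ han)] at this
    exact this
  rw [pat2_13_eq, sum_range_pad (n := n) (by omega) (by omega : 2 * m ≤ n + 1), sum_range_two_mul,
    ← Fin.sum_univ_eq_sum_range (fun i => ∑ b ∈ range n, (if b + 1 < n ∧ 2 * i < b ∧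
        ext σ b < ext σ (2 * i) ∧ ext σ (2 * i) < ext σ (b + 1) then 1 else 0) +
      ∑ b ∈ range n, (if b + 1 < n ∧ 2 * i + 1 < b ∧ ext σ b < ext σ (2 * i + 1) ∧
        ext σ (2 * i + 1) < ext σ (b + 1) then 1 else 0))]
  · refine Finset.sum_congr rfl fun i _ => ?_
    have e1 := (rgt_toWord m σ i (toWord m σ i).1).trans (hr (ext σ (2 * i)) i)
    have e2 := (rgt_toWord m σ i (toWord m σ i).2).trans (hr (ext σ (2 * i + 1)) i)
    rw [e1, e2, inner _ i i.isLt (Or.inl rfl), inner _ i i.isLt (Or.inr rfl)]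
    congr 1
    · have := tele _ i i.isLt (Or.inl rfl) (by omega)
      rw [if_pos (c := ext σ (2 * i.val + 1) < ext σ (2 * i.val)) (H.desc i i.isLt)] at this
      omega
    · by_cases hi : 2 * i.val + 1 < n
      · have := tele _ i i.isLt (Or.inr rfl) hi
        rw [if_neg (c := ext σ (2 * i.val + 1) < ext σ (2 * i.val + 1)) (lt_irrefl _)] at this
        omega
      -- The final valley is the artificial `0`, for which both counts vanish.
      · rw [ext_of_le σ (not_lt.mp hi)]
        simp
  · refine Finset.sum_eq_zero fun b _ => if_neg ?_
    rw [ext_of_le σ le_rfl]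
    omega

lemma sum_alternating_eq_wordSum {m d : ℕ} (hd : d ≤ 1) (hm : 2 * m = n + d) :
    ∑ σ ∈ alternating n, wordWeight p q d (toWord m σ) = wordSum p q n m d 1 := by
  classical
  rw [wordSum]
  refine Finset.sum_bij (fun σ _ => toWord m σ) ?_ ?_ ?_ ?_
  · exact fun σ hσ => Finset.mem_filter.mpr ⟨Finset.mem_univ _,
      isZig_toWord hd hm ((mem_alternating_iff hd hm σ).mp hσ)⟩
  · exact fun _ _ _ _ h => toWord_injective hm h
  · intro w hw
    have hw := (Finset.mem_filter.mp hw).2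
    obtain ⟨σ, rfl⟩ := exists_toWord_eq hd hm hw
    refine ⟨σ, (mem_alternating_iff hd hm σ).mpr ⟨fun i hi => hw.desc ⟨i, hi⟩, fun i hi => ?_⟩,
      rfl⟩
    exact hw.asc ⟨i, by omega⟩ ⟨i + 1, hi⟩ rfl
  · exact fun _ _ => rfl

lemma sum_alternating_even (hn : Even n) :
    ∑ σ ∈ alternating n, p ^ pat2_31 σ * q ^ pat31_2 σ = zigSum p q 0 n 0 := by
  obtain ⟨m, hm⟩ := hn
  have hm : 2 * m = n + 0 := by omega
  rw [← wordSum_eq_zigSum (n := n) p q 0 zero_le_one n 1 0 m le_rfl (by omega) (by omega),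
    ← sum_alternating_eq_wordSum p q zero_le_one hm]
  refine Finset.sum_congr rfl fun σ hσ => ?_
  have H := (mem_alternating_iff zero_le_one hm σ).mp hσ
  rw [wordWeight_eq_pow, pat31_2_eq_lft zero_le_one hm H, pat2_31_eq_rgt hm H]

lemma sum_alternating_odd (hn : ¬ Even n) :
    ∑ σ ∈ alternating n, p ^ pat2_13 σ * q ^ pat31_2 σ = zigSum p q 1 n 1 := by
  obtain ⟨m, hm⟩ := Nat.not_even_iff_odd.mp hn
  have hm : 2 * (m + 1) = n + 1 := by omega
  rw [← wordSum_eq_zigSum (n := n) p q 1 le_rfl n 1 1 (m + 1) le_rfl (by omega) (by omega),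
    ← sum_alternating_eq_wordSum p q le_rfl hm]
  refine Finset.sum_congr rfl fun σ hσ => ?_
  have H := (mem_alternating_iff le_rfl hm σ).mp hσ
  rw [wordWeight_eq_pow, pat31_2_eq_lft le_rfl hm H, pat2_13_eq_rgt hm H]

end Transfer

end PermStat

theorem mainTheorem4 {R : Type*} [CommRing R] (n : ℕ) (hn : 1 ≤ n) :
    (∀ p q : R,
      ∑ σ : Equiv.Perm (Fin n),
          (-1 : R) ^ PermStat.wex σ * p ^ PermStat.nest σ * q ^ PermStat.cros σ =
        if Even n then 0
        else (-1 : R) ^ ((n + 1) / 2) *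
          ∑ σ ∈ PermStat.alternating n,
            p ^ PermStat.pat2_13 σ * q ^ PermStat.pat31_2 σ) ∧
    (∀ (p : R) (q : Rˣ),
      ∑ σ : derangements (Fin n),
          (-((q⁻¹ : Rˣ) : R)) ^ PermStat.exc σ.val *
            p ^ PermStat.nest σ.val * (q : R) ^ PermStat.cros σ.val =
        if Even n then
          (-((q⁻¹ : Rˣ) : R)) ^ (n / 2) *
            ∑ σ ∈ PermStat.alternating n,
              p ^ PermStat.pat2_31 σ * (q : R) ^ PermStat.pat31_2 σ
        else 0) := by
  refine ⟨fun p q => ?_, fun p q => ?_⟩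
  · rw [PermStat.sum_perm_eq_zigSum p q n hn]
    split_ifs with h
    · rfl
    · rw [PermStat.sum_alternating_odd p q h]
  · rw [PermStat.sum_derangements_eq_zigSum p q n]
    split_ifs with h
    · rw [PermStat.sum_alternating_even p (q : R) h]
    · rfl
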